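/- **Setting.** Let $d\ge 1$, $A,B\in\mathbb R^{d\times d}$, $\lambda_0\in\mathbb R^d$ with $\lambda_0\ge 0$ (inequalities between vectors are componentwise), and for $k=1,\dots,d$ let $\nu_k(\lambda,dx)$ be a probability kernel from $\mathbb R^d$ to $\mathbb R$. A *linear self-exciting jump process started at $\lambda\ge\lambda_0$* consists of event times $0<T_1<T_2<\cdots$ (strictly increasing as long as they are finite, possibly $\infty$, with only finitely many of them in bounded intervals a.s.), event types $X_n\in\{1,\dots,d\}$, sizes $Y^k_n\ge 0$, and an intensity process $\lambda(t)=(\lambda_1(t),\dots,\lambda_d(t))^\top$ with values in the state space $\{\lambda\ge\lambda_0\}$ a.s., on a probability space with a filtration $(\mathcal F_t)_{t\ge0}$ to which the counting processes $N_k(t)=\sum_n 1_{\{X_n=k,\,T_n\le t\}}$ and $\lambda(t)$ are adapted, such that * $d\lambda(t)=A(\lambda(t)-\lambda_0)\,dt+B\,dU(t)$ and $\lambda(0)=\lambda$ a.s., where $U_k(t)=\sum_{n:\,T_n\le t}Y^k_n1_{\{X_n=k\}}$; * $\lambda_k(t)$ is the $\mathcal F_t$-intensity of $N_k$: $\mathbb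 E\int_0^\infty H(s)\,dN_k(s)=\mathbb E\int_0^\infty H(s)\lambda_k(s)\,ds$ for every nonnegative predictable $H$; * conditionally on the history strictly before $T_n$ and on $\{X_n=k,\ T_n<\infty\}$, the size $Y^k_n$ has law $\nu_k(\lambda(T_n-),\cdot)$, i.e. $\mathbb E[H(T_n)1_{\{X_n=k,T_n<\infty,Y_n^k\in S\}}]=\mathbb E[H(T_n)1_{\{X_n=k,T_n<\infty\}}\nu_k(\lambda(T_n-),S)]$ for all nonnegative predictable $H$ and Borel sets $S$. $\mathbb E_\lambda$ denotes expectation for the process started at $\lambda$. **Assumption.** For $\lambda\ge\lambda_0$ let $J(\lambda)$ be the diagonal matrix with entries $\int x\,\nu_k(\lambda,dx)$, let $M(\lambda)=A+BJ(\lambda)$, and let $\gamma_1(\lambda)$ be the largest eigenvalue of $M(\lambda)+M(\lambda)^\top$. Assume that, for all $\lambda\ge\lambda_0$, $M(\lambda)$ is diagonalisable (over $\mathbb C$) and all eigenvalues of $M(\lambda)+M(\lambda)^\top$ are negative; that the moments $\int x\,\nu_k(\lambda,dx)$ and $\int x^2\,\nu_k(\lambda,dx)$ exist and are bounded as functions of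 $\lambda\ge\lambda_0$; and that $\sup_{\lambda\ge\lambda_0}\gamma_1(\lambda)<0$. **Proposition.** Let $\|\cdot\|$ be any norm on $\mathbb R^d$, write $\|\lambda\|_2^2=\lambda^\top\lambda$, and put $C_1=-\sup_{\lambda\ge\lambda_0}\gamma_1(\lambda)$. Then $C_1>0$ and there are constants $C,C_2>0$, depending neither on the starting point nor on $t$, such that for every $\lambda\ge\lambda_0$, every linear self-exciting jump process started at $\lambda$ and every $t\ge 0$, the random variable $\|\lambda(t)\|$ is integrable and $$\mathbb E_\lambda\big[\|\lambda(t)\|\big]\le C\left(\frac{C_2}{C_1}+\Big(\|\lambda\|_2^2-\frac{C_2}{C_1}\Big)e^{-C_1t}\right)^{1/2},$$ with strict inequality unless $t=0$ and $\lambda=0$ (when both sides vanish). In particular $t\mapsto\mathbb E_\lambda[\|\lambda(t)\|]$ is bounded. -/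

import Mathlib

open MeasureTheory ProbabilityTheory Filter
open scoped NNReal ENNReal Topology

namespace SelfExciting

/-- Diagonalisability of a real square matrix, with complex eigenvectors and eigenvalues allowed. -/
def IsDiagonalisable {d : ℕ} (M : Matrix (Fin d) (Fin d) ℝ) : Prop :=
  ∃ (Q : Matrix (Fin d) (Fin d) ℂ) (D : Fin d → ℂ),
    IsUnit Q.det ∧ M.map (fun r : ℝ => (r : ℂ)) * Q = Q * Matrix.diagonal D

/-- The largest real eigenvalue of a matrix (used for symmetric matrices, where the set of
eigenvalues is finite and, for `d ≥ 1`, nonempty, so that the supremum is a maximum). -/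
noncomputable def largestEigenvalue {d : ℕ} (S : Matrix (Fin d) (Fin d) ℝ) : ℝ :=
  sSup {r : ℝ | Module.End.HasEigenvalue (Matrix.toLin' S) r}

/-- `J(λ)`: the diagonal matrix of the mean jump sizes `∫ x ν_k(λ, dx)`. -/
noncomputable def meanJump {d : ℕ} (ν : Fin d → Kernel (Fin d → ℝ) ℝ) (l : Fin d → ℝ) :
    Matrix (Fin d) (Fin d) ℝ :=
  Matrix.diagonal fun k => ∫ x, x ∂(ν k l)

/-- `M(λ) = A + B J(λ)`. -/
noncomputable def driftMatrix {d : ℕ} (A B : Matrix (Fin d) (Fin d) ℝ)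
    (ν : Fin d → Kernel (Fin d → ℝ) ℝ) (l : Fin d → ℝ) : Matrix (Fin d) (Fin d) ℝ :=
  A + B * meanJump ν l

/-- `γ₁(λ)`: the largest eigenvalue of `M(λ) + M(λ)ᵀ`. -/
noncomputable def gammaOne {d : ℕ} (A B : Matrix (Fin d) (Fin d) ℝ)
    (ν : Fin d → Kernel (Fin d → ℝ) ℝ) (l : Fin d → ℝ) : ℝ :=
  largestEigenvalue (driftMatrix A B ν l + (driftMatrix A B ν l).transpose)

/-- `sup γ₁(λ)` over the state space `{λ | λ ≥ λ₀}`. -/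
noncomputable def supGamma {d : ℕ} (A B : Matrix (Fin d) (Fin d) ℝ) (l₀ : Fin d → ℝ)
    (ν : Fin d → Kernel (Fin d → ℝ) ℝ) : ℝ :=
  ⨆ l : Set.Ici l₀, gammaOne A B ν l

/-- The standing assumption on the linear model. -/
structure LinearAssumption {d : ℕ} (A B : Matrix (Fin d) (Fin d) ℝ) (l₀ : Fin d → ℝ)
    (ν : Fin d → Kernel (Fin d → ℝ) ℝ) : Prop where
  diagonalisable : ∀ l, l₀ ≤ l → IsDiagonalisable (driftMatrix A B ν l)
  integrable_first : ∀ k l, l₀ ≤ l → Integrable (fun x : ℝ => x) (ν k l)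
  bounded_first : ∃ K : ℝ, ∀ k l, l₀ ≤ l → |∫ x, x ∂(ν k l)| ≤ K
  integrable_second : ∀ k l, l₀ ≤ l → Integrable (fun x : ℝ => x ^ 2) (ν k l)
  bounded_second : ∃ K : ℝ, ∀ k l, l₀ ≤ l → ∫ x, x ^ 2 ∂(ν k l) ≤ K
  eigenvalues_neg : ∀ l, l₀ ≤ l → ∀ r : ℝ,
    Module.End.HasEigenvalue
      (Matrix.toLin' (driftMatrix A B ν l + (driftMatrix A B ν l).transpose)) r → r < 0
  sup_neg : supGamma A B l₀ ν < 0

/-- `N_k(t)`: the number of events of type `k` up to time `t`. The `n`-th event (`n = 0, 1, …`) has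
time `T n` (which is `∞` if there are at most `n` events) and type `X n`. -/
noncomputable def counting {d : ℕ} {Ω : Type*} (T : ℕ → Ω → ℝ≥0∞) (X : ℕ → Ω → Fin d)
    (k : Fin d) (t : ℝ≥0) (ω : Ω) : ℕ∞ :=
  {n : ℕ | X n ω = k ∧ T n ω ≤ t}.encard

open Classical in
/-- `U_k(t)`: the sum of the sizes of the events of type `k` up to time `t`; the `n`-th event,
when it is of type `k`, has size `Y n k`. -/
noncomputable def jumpSum {d : ℕ} {Ω : Type*} (T : ℕ → Ω → ℝ≥0∞) (X : ℕ → Ω → Fin d)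
    (Y : ℕ → Fin d → Ω → ℝ) (t : ℝ≥0) (ω : Ω) (k : Fin d) : ℝ :=
  ∑' n, if X n ω = k ∧ T n ω ≤ t then Y n k ω else 0

open Classical in
/-- `∫ H dN_k`: the sum of `H` over the event times of type `k`. -/
noncomputable def integralCounting {d : ℕ} {Ω : Type*} (T : ℕ → Ω → ℝ≥0∞) (X : ℕ → Ω → Fin d)
    (k : Fin d) (H : ℝ≥0 → Ω → ℝ≥0∞) (ω : Ω) : ℝ≥0∞ :=
  ∑' n, if X n ω = k ∧ T n ω < ∞ then H (T n ω).toNNReal ω else 0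

/-- Under `P`, with history `𝓕`, the event times `T`, event types `X`, event sizes `Y` and intensity
`lam` form a linear self-exciting jump process with parameters `A`, `B`, `l₀`, `ν`, initial
intensity `lam 0 = l` and state space `{λ | λ ≥ l₀}`. -/
structure IsLinearModel {d : ℕ} (A B : Matrix (Fin d) (Fin d) ℝ) (l₀ : Fin d → ℝ)
    (ν : Fin d → Kernel (Fin d → ℝ) ℝ) (l : Fin d → ℝ)
    {Ω : Type*} [mΩ : MeasurableSpace Ω] (P : Measure Ω) (𝓕 : Filtration ℝ≥0 mΩ)
    (T : ℕ → Ω → ℝ≥0∞) (X : ℕ → Ω → Fin d) (Y : ℕ → Fin d → Ω → ℝ)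
    (lam : ℝ≥0 → Ω → Fin d → ℝ) : Prop where
  measurable_time : ∀ n, Measurable (T n)
  measurable_type : ∀ n, Measurable (X n)
  measurable_size : ∀ n k, Measurable (Y n k)
  -- event times are positive and strictly increasing as long as they are finite
  time_pos : ∀ n ω, 0 < T n ω
  time_lt : ∀ n ω, T n ω < ∞ → T n ω < T (n + 1) ω
  time_mono : ∀ ω, Monotone fun n => T n ω
  size_nonneg : ∀ n k ω, 0 ≤ Y n k ω
  -- non-explosion
  nonexplosive : ∀ᵐ ω ∂P, ∀ t : ℝ≥0, {n : ℕ | T n ω ≤ t}.Finite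
  adapted_counting : ∀ k, Adapted 𝓕 (counting T X k)
  adapted_intensity : Adapted 𝓕 lam
  -- the state space
  mem_state : ∀ᵐ ω ∂P, ∀ t, l₀ ≤ lam t ω
  -- `dλ(t) = A (λ(t) - λ₀) dt + B dU(t)`, `λ(0) = l`, in integrated form
  integrable_path : ∀ᵐ ω ∂P, ∀ t : ℝ≥0,
    IntervalIntegrable (fun s : ℝ => lam s.toNNReal ω) volume 0 t
  equation : ∀ᵐ ω ∂P, ∀ t : ℝ≥0,
    lam t ω = l + (∫ s in (0 : ℝ)..t, A.mulVec (lam s.toNNReal ω - l₀))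
      + B.mulVec (jumpSum T X Y t ω)
  -- `lam · k` is the `𝓕`-intensity of the counting process of type `k`
  intensity : ∀ (k : Fin d) (H : ℝ≥0 → Ω → ℝ≥0∞), IsStronglyPredictable 𝓕 H →
    ∫⁻ ω, integralCounting T X k H ω ∂P
      = ∫⁻ ω, (∫⁻ s in Set.Ici (0 : ℝ), H s.toNNReal ω * ENNReal.ofReal (lam s.toNNReal ω k)) ∂P
  -- given the history strictly before `T n` and given that `T n` is finite and the type is `k`,
  -- the size has law `ν_k(λ(T n -), ·)`
  size_law : ∀ (n : ℕ) (k : Fin d) (S : Set ℝ), MeasurableSet S →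
    ∀ H : ℝ≥0 → Ω → ℝ≥0∞, IsStronglyPredictable 𝓕 H →
    ∫⁻ ω in {ω | X n ω = k ∧ T n ω < ∞ ∧ Y n k ω ∈ S}, H (T n ω).toNNReal ω ∂P
      = ∫⁻ ω in {ω | X n ω = k ∧ T n ω < ∞}, H (T n ω).toNNReal ω *
          ν k (Function.leftLim (fun s => lam s ω) (T n ω).toNNReal) S ∂P

end SelfExciting

/-! Write |x| for the Euclidean norm. Applied to |x|², the generator of the process gives 2 x·A(x -
λ₀) plus the sum over k of x_k ∫ (2y x·B_k + y²|B_k|²) ν_k(x,dy), where B_k is the k-th column of B.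
The mean jumps combine with A to give 2 x·M(x)x, which is at most -C₁|x|² by the spectral
hypothesis. The remaining terms are linear in |x|, since the second moments are bounded. Hence the
generator of |x|² is at most -C₁|x|² + c|x| (`LinearAssumption.generator_le`).

If Φ = φ(|x|²) with φ concave and nondecreasing, the tangent inequality bounds every jump of Φ by φ'
at the left limit times the jump of |x|². So the generator of Φ is at most φ' times that of |x|².
Pathwise this is `IsJumpPath.energy_le`. In expectation it is `IsLinearModel.integral_energy_le`,
where the jump sums are replaced by their compensators (`IsLinearModel.integral_tsum_size`). That
replacement needs predictable integrands, which are obtained from left limits along a grid.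

No moment of the intensity is known beforehand, so the inequality is used twice. The bounded energy
|x|²/(1+ε|x|²) gives a second moment growing at most linearly in time, by Fatou as ε → 0; this
supplies all integrability. The energy √(|x|²+δ), smooth at the origin, then gives, as δ → 0,
E|λ(t)| ≤ |λ| a + (c/C₁)(1-a) with a = exp(-C₁t/2). Squaring this interpolation costs a factor 2 and
produces the stated form; any other norm is dominated by a multiple of |x|. -/

namespace SelfExciting

/-! ### Quadratic forms and the generator of the squared norm -/

open Matrix in
theorem dotProduct_mulVec_le_of_eigenvalue_le {d : ℕ} {S : Matrix (Fin d) (Fin d) ℝ}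
    (hS : S.IsHermitian) {c : ℝ}
    (hc : ∀ r, Module.End.HasEigenvalue (Matrix.toLin' S) r → r ≤ c) (x : Fin d → ℝ) :
    x ⬝ᵥ S *ᵥ x ≤ c * (x ⬝ᵥ x) := by
  have hR : (c • (1 : Matrix (Fin d) (Fin d) ℝ) - S).IsHermitian :=
    (Matrix.isHermitian_one.smul (k := c) (by simp [IsSelfAdjoint])).sub hS
  -- An eigenvector of c·1 - S with eigenvalue μ is one of S with eigenvalue c - μ ≤ c, so μ ≥ 0.
  have hpos : (c • (1 : Matrix (Fin d) (Fin d) ℝ) - S).PosSemidef := by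
    rw [hR.posSemidef_iff_eigenvalues_nonneg]
    intro i
    have h1 := hR.mulVec_eigenvectorBasis i
    have h2 : S *ᵥ ⇑(hR.eigenvectorBasis i)
        = (c - hR.eigenvalues i) • ⇑(hR.eigenvectorBasis i) := by
      rw [Matrix.sub_mulVec, Matrix.smul_mulVec, Matrix.one_mulVec] at h1
      rw [sub_smul, ← h1]; abel
    have h3 := hc (c - hR.eigenvalues i) (Module.End.hasEigenvalue_of_hasEigenvector
      (x := ⇑(hR.eigenvectorBasis i)) ⟨by
        rw [Module.End.mem_eigenspace_iff, Matrix.toLin'_apply]; exact h2, by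
        intro h0
        exact hR.eigenvectorBasis.orthonormal.ne_zero i (by ext j; exact congrFun h0 j)⟩)
    simp only [Pi.zero_apply]; linarith
  have h := hpos.dotProduct_mulVec_nonneg x
  simp only [star_trivial, Matrix.sub_mulVec, Matrix.smul_mulVec, Matrix.one_mulVec,
    dotProduct_sub, dotProduct_smul, smul_eq_mul] at h
  linarith

theorem dotProduct_le_sqrt {d : ℕ} (x y : Fin d → ℝ) : x ⬝ᵥ y ≤ √(x ⬝ᵥ x) * √(y ⬝ᵥ y) := by
  simpa [dotProduct, sq] using Real.sum_mul_le_sqrt_mul_sqrt Finset.univ x y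

theorem abs_dotProduct_le_sqrt {d : ℕ} (x y : Fin d → ℝ) :
    |x ⬝ᵥ y| ≤ √(x ⬝ᵥ x) * √(y ⬝ᵥ y) := by
  refine abs_le.2 ⟨?_, dotProduct_le_sqrt x y⟩
  have := dotProduct_le_sqrt (-x) y
  simp only [neg_dotProduct, dotProduct_neg, neg_neg] at this
  linarith

theorem dotProduct_self_nonneg {d : ℕ} (x : Fin d → ℝ) : 0 ≤ x ⬝ᵥ x :=
  Finset.sum_nonneg fun i _ => mul_self_nonneg (x i)

theorem abs_apply_le_sqrt {d : ℕ} (x : Fin d → ℝ) (k : Fin d) : |x k| ≤ √(x ⬝ᵥ x) := by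
  rw [← Real.sqrt_sq_eq_abs]
  refine Real.sqrt_le_sqrt ?_
  rw [sq]
  exact Finset.single_le_sum (f := fun i => x i * x i) (fun i _ => mul_self_nonneg (x i))
    (Finset.mem_univ k)

/-- The bound for the quadratic form of the drift matrix. -/
theorem LinearAssumption.dotProduct_driftMatrix_le {d : ℕ} {A B : Matrix (Fin d) (Fin d) ℝ}
    {l₀ : Fin d → ℝ} {ν : Fin d → Kernel (Fin d → ℝ) ℝ} (hA : LinearAssumption A B l₀ ν)
    {x : Fin d → ℝ} (hx : l₀ ≤ x) :
    2 * (x ⬝ᵥ (driftMatrix A B ν x).mulVec x) ≤ supGamma A B l₀ ν * (x ⬝ᵥ x) := by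
  set M := driftMatrix A B ν x with hM
  have hbdd : BddAbove {r : ℝ | Module.End.HasEigenvalue (Matrix.toLin' (M + M.transpose)) r} :=
    ⟨0, fun r hr => (hA.eigenvalues_neg x hx r hr).le⟩
  -- A real supremum is meaningful only for a bounded family. Negativity of all the eigenvalues
  -- supplies the bound 0, both for each spectrum and for the family over the state space.
  have hg : gammaOne A B ν x ≤ supGamma A B l₀ ν := by
    refine le_ciSup (f := fun l : Set.Ici l₀ => gammaOne A B ν l) ⟨0, ?_⟩ ⟨x, hx⟩
    rintro _ ⟨⟨l, hl⟩, rfl⟩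
    exact Real.sSup_nonpos fun r hr => (hA.eigenvalues_neg l hl r hr).le
  have h := dotProduct_mulVec_le_of_eigenvalue_le (S := M + M.transpose)
    (by simp [Matrix.IsHermitian, add_comm]) (c := supGamma A B l₀ ν)
    (fun r hr => (le_csSup hbdd hr).trans hg) x
  rw [Matrix.add_mulVec, dotProduct_add, Matrix.mulVec_transpose, dotProduct_comm x (Matrix.vecMul x M),
    ← Matrix.dotProduct_mulVec] at h
  linarith

/-- The bound for the generator of the process applied to `x ↦ x ⬝ᵥ x`. -/
theorem LinearAssumption.generator_le {d : ℕ} {A B : Matrix (Fin d) (Fin d) ℝ}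
    {l₀ : Fin d → ℝ} {ν : Fin d → Kernel (Fin d → ℝ) ℝ}
    (hA : LinearAssumption A B l₀ ν) :
    ∃ c > 0, ∀ x, l₀ ≤ x →
      2 * (x ⬝ᵥ A.mulVec (x - l₀)) + ∑ k, x k * (2 * (x ⬝ᵥ B.col k) * ∫ y, y ∂(ν k x)
          + (B.col k ⬝ᵥ B.col k) * ∫ y, y ^ 2 ∂(ν k x))
        ≤ supGamma A B l₀ ν * (x ⬝ᵥ x) + c * √(x ⬝ᵥ x) := by
  obtain ⟨K, hK⟩ := hA.bounded_second
  -- The first term absorbs -2 x·Aλ₀, the second the squared jump sizes through |x_k| ≤ |x|; the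
  -- summand 1 only makes the constant positive.
  refine ⟨2 * √(A.mulVec l₀ ⬝ᵥ A.mulVec l₀) + ∑ k, (B.col k ⬝ᵥ B.col k) * |K| + 1, ?_, ?_⟩
  · have : 0 ≤ ∑ k, (B.col k ⬝ᵥ B.col k) * |K| :=
      Finset.sum_nonneg fun k _ => mul_nonneg (dotProduct_self_nonneg _) (abs_nonneg _)
    positivity
  intro x hx
  have h1 := hA.dotProduct_driftMatrix_le hx
  -- The mean jumps, arriving at rates x_k, contribute exactly x·BJ(x)x; this is how M(x) replaces
  -- A.
  have h2 : x ⬝ᵥ (driftMatrix A B ν x).mulVec x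
      = x ⬝ᵥ A.mulVec x + ∑ k, x k * ((x ⬝ᵥ B.col k) * ∫ y, y ∂(ν k x)) := by
    rw [driftMatrix, Matrix.add_mulVec, dotProduct_add, ← Matrix.mulVec_mulVec,
      Matrix.dotProduct_mulVec x B, meanJump]
    congr 1
    simp only [dotProduct, Matrix.mulVec_diagonal]
    refine Finset.sum_congr rfl fun k _ => ?_
    simp only [Matrix.vecMul, dotProduct, Matrix.col_apply]
    ring
  have h3 : -(x ⬝ᵥ A.mulVec l₀) ≤ √(x ⬝ᵥ x) * √(A.mulVec l₀ ⬝ᵥ A.mulVec l₀) :=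
    (neg_le_abs _).trans (abs_dotProduct_le_sqrt _ _)
  have h4 : ∑ k, x k * ((B.col k ⬝ᵥ B.col k) * ∫ y, y ^ 2 ∂(ν k x))
      ≤ ∑ k, √(x ⬝ᵥ x) * ((B.col k ⬝ᵥ B.col k) * |K|) := by
    refine Finset.sum_le_sum fun k _ => ?_
    refine mul_le_mul ((le_abs_self _).trans (abs_apply_le_sqrt x k))
      (mul_le_mul_of_nonneg_left ((hK k x hx).trans (le_abs_self K)) (dotProduct_self_nonneg _))
      (mul_nonneg (dotProduct_self_nonneg _) (integral_nonneg fun y => sq_nonneg y))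
      (Real.sqrt_nonneg _)
  rw [← Finset.mul_sum] at h4
  have h5 : ∑ k, x k * (2 * (x ⬝ᵥ B.col k) * ∫ y, y ∂(ν k x)
          + (B.col k ⬝ᵥ B.col k) * ∫ y, y ^ 2 ∂(ν k x))
      = 2 * ∑ k, x k * ((x ⬝ᵥ B.col k) * ∫ y, y ∂(ν k x))
        + ∑ k, x k * ((B.col k ⬝ᵥ B.col k) * ∫ y, y ^ 2 ∂(ν k x)) := by
    rw [Finset.mul_sum, ← Finset.sum_add_distrib]
    exact Finset.sum_congr rfl fun k _ => by ring
  rw [h5, Matrix.mulVec_sub, dotProduct_sub]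
  have h6 := Real.sqrt_nonneg (x ⬝ᵥ x)
  nlinarith [h1, h2, h3, h4, h6]

/-! ### Concave energies and single paths -/

/-- A pair `Φ = φ (x ⬝ᵥ x)`, `q = φ' (x ⬝ᵥ x)` with `φ` nonnegative, nondecreasing and concave, in
terms of the properties that are needed to study `Φ` along the paths of the intensity process. -/
structure IsConcaveEnergy {d : ℕ} (Φ q : (Fin d → ℝ) → ℝ) : Prop where
  continuous_energy : Continuous Φ
  continuous_slope : Continuous q
  energy_nonneg : ∀ x, 0 ≤ Φ x
  slope_nonneg : ∀ x, 0 ≤ q x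
  tangent : ∀ x y, Φ y ≤ Φ x + q x * (y ⬝ᵥ y - x ⬝ᵥ x)
  hasDeriv : ∀ (u : ℝ → Fin d → ℝ) (u' : Fin d → ℝ) (s : ℝ), HasDerivWithinAt u u' (Set.Ici s) s →
    HasDerivWithinAt (fun r => Φ (u r)) (q (u s) * (2 * (u s ⬝ᵥ u'))) (Set.Ici s) s

open Classical in
/-- A single path of a linear self-exciting jump process. -/
structure IsJumpPath {d : ℕ} (A B : Matrix (Fin d) (Fin d) ℝ) (l₀ l : Fin d → ℝ)
    (T : ℕ → ℝ≥0∞) (X : ℕ → Fin d) (Y : ℕ → Fin d → ℝ) (x : ℝ≥0 → Fin d → ℝ) : Prop where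
  time_pos : ∀ n, 0 < T n
  time_lt : ∀ n, T n < ∞ → T n < T (n + 1)
  time_mono : Monotone T
  finite : ∀ t : ℝ≥0, {n : ℕ | T n ≤ t}.Finite
  integrable_path : ∀ t : ℝ≥0, IntervalIntegrable (fun s : ℝ => x s.toNNReal) volume 0 t
  equation : ∀ t : ℝ≥0, x t = l + (∫ s in (0 : ℝ)..t, A.mulVec (x s.toNNReal - l₀))
    + B.mulVec (fun k => ∑' n, if X n = k ∧ T n ≤ t then Y n k else 0)

/-! ### Change of variables along a path -/

namespace IsJumpPath

variable {d : ℕ} {A B : Matrix (Fin d) (Fin d) ℝ} {l₀ l : Fin d → ℝ}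
    {T : ℕ → ℝ≥0∞} {X : ℕ → Fin d} {Y : ℕ → Fin d → ℝ} {x : ℝ≥0 → Fin d → ℝ}

/-- The jump of the path at the `n`-th event time. -/
noncomputable def jump (B : Matrix (Fin d) (Fin d) ℝ) (X : ℕ → Fin d) (Y : ℕ → Fin d → ℝ) (n : ℕ) :
    Fin d → ℝ :=
  Y n (X n) • B.col (X n)

/-- The continuous part of the path. -/
noncomputable def contPart (A : Matrix (Fin d) (Fin d) ℝ) (l₀ l : Fin d → ℝ)
    (x : ℝ≥0 → Fin d → ℝ) (s : ℝ) : Fin d → ℝ :=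
  l + ∫ u in (0 : ℝ)..s, A.mulVec (x u.toNNReal - l₀)

/-- The events up to time `b`. -/
noncomputable def events (h : IsJumpPath A B l₀ l T X Y x) (b : ℝ≥0) : Finset ℕ :=
  (h.finite b).toFinset

theorem mem_events (h : IsJumpPath A B l₀ l T X Y x) {b : ℝ≥0} {n : ℕ} :
    n ∈ h.events b ↔ T n ≤ b := by simp [events]

open Classical in
theorem eq_contPart_add (h : IsJumpPath A B l₀ l T X Y x) {b t : ℝ≥0} (htb : t ≤ b) :
    x t = contPart A l₀ l x t + ∑ n ∈ h.events b, if T n ≤ t then jump B X Y n else 0 := by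
  rw [h.equation t, contPart]
  congr 1
  have h1 : (fun k => ∑' n, if X n = k ∧ T n ≤ t then Y n k else 0)
      = fun k => ∑ n ∈ h.events b, if X n = k ∧ T n ≤ t then Y n k else 0 := by
    funext k
    refine tsum_eq_sum fun n hn => if_neg fun h2 => hn ?_
    exact h.mem_events.2 (h2.2.trans (by exact_mod_cast htb))
  rw [h1]
  ext i
  simp only [Matrix.mulVec, dotProduct, Finset.sum_apply, Finset.mul_sum]
  rw [Finset.sum_comm]
  refine Finset.sum_congr rfl fun n _ => ?_
  by_cases h2 : T n ≤ t
  · simp [h2, jump, mul_comm]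
  · simp [h2]

/-- Right continuity of the event sums: an event already counted at s stays counted, and one
strictly after s remains uncounted for a short while. -/
theorem eventually_le_iff_le (τ : ℝ≥0∞) (s : ℝ) :
    ∀ᶠ r in 𝓝[≥] s, (τ ≤ ENNReal.ofReal r ↔ τ ≤ ENNReal.ofReal s) := by
  by_cases hτ : τ ≤ ENNReal.ofReal s
  · filter_upwards [self_mem_nhdsWithin] with r hr
    exact iff_of_true (hτ.trans (ENNReal.ofReal_le_ofReal hr)) hτ
  · have : ∀ᶠ r in 𝓝 s, ENNReal.ofReal r < τ :=
      (ENNReal.continuous_ofReal.tendsto s).eventually_lt_const (not_le.1 hτ)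
    filter_upwards [nhdsWithin_le_nhds this] with r hr
    exact iff_of_false (not_le.2 hr) hτ

/-- Seen from the left of s, an event at s itself has not yet happened, so the weak inequality
becomes strict in the limit. -/
theorem eventually_le_iff_lt (τ : ℝ≥0∞) (s : ℝ≥0) :
    ∀ᶠ r : ℝ≥0 in 𝓝[<] s, (τ ≤ r ↔ τ < s) := by
  by_cases hτ : τ < s
  · have : ∀ᶠ r : ℝ≥0 in 𝓝 s, τ < r :=
      (ENNReal.continuous_coe.tendsto s).eventually_const_lt hτ
    filter_upwards [nhdsWithin_le_nhds this] with r hr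
    exact iff_of_true hr.le hτ
  · filter_upwards [self_mem_nhdsWithin] with r hr
    refine iff_of_false (fun h => hτ (h.trans_lt ?_)) hτ
    exact_mod_cast hr

theorem intervalIntegrable_mulVec (h : IsJumpPath A B l₀ l T X Y x) (b : ℝ≥0) :
    IntervalIntegrable (fun u : ℝ => A.mulVec (x u.toNNReal - l₀)) volume 0 b := by
  have h1 := (h.integrable_path b).sub (intervalIntegrable_const (c := l₀))
  rw [intervalIntegrable_iff] at h1 ⊢
  exact (LinearMap.toContinuousLinearMap A.mulVecLin).integrable_comp h1

theorem continuousOn_contPart (h : IsJumpPath A B l₀ l T X Y x) (b : ℝ≥0) :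
    ContinuousOn (contPart A l₀ l x) (Set.Icc 0 b) := by
  refine continuousOn_const.add ?_
  have := intervalIntegral.continuousOn_primitive_interval (μ := volume) (a := 0) (b := (b : ℝ))
    (f := fun u : ℝ => A.mulVec (x u.toNNReal - l₀)) ?_
  · rwa [Set.uIcc_of_le b.coe_nonneg] at this
  · rw [Set.uIcc_of_le b.coe_nonneg, ← intervalIntegrable_iff_integrableOn_Icc_of_le b.coe_nonneg]
    exact h.intervalIntegrable_mulVec b

open Classical in
/-- The left limit of the path at `s`, when `s ≤ b`. -/
noncomputable def left (h : IsJumpPath A B l₀ l T X Y x) (b : ℝ≥0) (s : ℝ≥0) : Fin d → ℝ :=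
  contPart A l₀ l x s + ∑ n ∈ h.events b, if T n < s then jump B X Y n else 0

theorem tendsto_left (h : IsJumpPath A B l₀ l T X Y x) {b s : ℝ≥0} (hsb : s ≤ b) :
    Tendsto x (𝓝[<] s) (𝓝 (h.left b s)) := by
  classical
  have hc : Tendsto (fun r : ℝ≥0 => contPart A l₀ l x r) (𝓝[<] s)
      (𝓝 (contPart A l₀ l x s)) := by
    refine ((h.continuousOn_contPart b) s ⟨s.2, by exact_mod_cast hsb⟩).tendsto.comp ?_
    refine tendsto_nhdsWithin_iff.2 ⟨?_, ?_⟩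
    · exact (NNReal.continuous_coe.tendsto s).mono_left nhdsWithin_le_nhds
    · filter_upwards [self_mem_nhdsWithin] with r hr
      exact ⟨r.2, by exact_mod_cast (le_of_lt hr).trans hsb⟩
  refine (hc.add_const (∑ n ∈ h.events b, if T n < s then jump B X Y n else 0)).congr' ?_
  have h1 : ∀ᶠ r : ℝ≥0 in 𝓝[<] s, ∀ n ∈ h.events b, (T n ≤ r ↔ T n < s) :=
    (Finset.eventually_all _).2 fun n _ => eventually_le_iff_lt (T n) s
  filter_upwards [h1, self_mem_nhdsWithin] with r hr hrs
  rw [h.eq_contPart_add ((le_of_lt hrs).trans hsb)]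
  congr 1
  exact Finset.sum_congr rfl fun n hn => by simp only [hr n hn]

theorem time_injective (h : IsJumpPath A B l₀ l T X Y x) {m n : ℕ} (hm : T m < ∞)
    (hmn : T m = T n) : m = n := by
  have key : ∀ m n, T m < ∞ → m < n → T m < T n := fun m n hm hmn =>
    (h.time_lt m hm).trans_le (h.time_mono hmn)
  rcases lt_trichotomy m n with h1 | h1 | h1
  · exact absurd hmn (key m n hm h1).ne
  · exact h1
  · exact absurd hmn (key n m (hmn ▸ hm) h1).ne'

open Classical in
theorem sum_le_eq_sum_lt (h : IsJumpPath A B l₀ l T X Y x) {E : Type*} [AddCommMonoid E]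
    (a : ℕ → E) {b s : ℝ≥0} (hs : ∀ n, T n ≠ s) :
    (∑ n ∈ h.events b, if T n ≤ s then a n else 0)
      = ∑ n ∈ h.events b, if T n < s then a n else 0 :=
  Finset.sum_congr rfl fun n _ => by simp only [(hs n).le_iff_lt]

open Classical in
theorem sum_le_eq_sum_lt_add (h : IsJumpPath A B l₀ l T X Y x) {E : Type*} [AddCommMonoid E]
    (a : ℕ → E) {b s : ℝ≥0} (hsb : s ≤ b) {n : ℕ} (hs : T n = s) :
    (∑ n ∈ h.events b, if T n ≤ s then a n else 0)
      = (∑ n ∈ h.events b, if T n < s then a n else 0) + a n := by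
  have h1 : ∀ m, (if T m ≤ s then a m else 0)
      = (if T m < s then a m else 0) + if m = n then a m else 0 := by
    intro m
    by_cases hm : m = n
    · simp [hm, hs]
    · have : T m ≠ s := fun h2 => hm (h.time_injective (by simp [h2]) (h2.trans hs.symm))
      simp [hm, this.le_iff_lt]
  simp only [h1, Finset.sum_add_distrib]
  congr 1
  rw [Finset.sum_ite_eq', if_pos]
  rw [h.mem_events, hs]
  exact_mod_cast hsb

theorem left_eq_self (h : IsJumpPath A B l₀ l T X Y x) {b s : ℝ≥0} (hsb : s ≤ b)
    (hs : ∀ n, T n ≠ s) : h.left b s = x s := by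
  rw [h.eq_contPart_add hsb, left, h.sum_le_eq_sum_lt _ hs]

theorem eq_left_add_jump (h : IsJumpPath A B l₀ l T X Y x) {b s : ℝ≥0} (hsb : s ≤ b) {n : ℕ}
    (hs : T n = s) : x s = h.left b s + jump B X Y n := by
  rw [h.eq_contPart_add hsb, left, h.sum_le_eq_sum_lt_add _ hsb hs, add_assoc]

/-- The path agrees with its left limits outside of the event times. -/
theorem tendsto_self_of_ne (h : IsJumpPath A B l₀ l T X Y x) {s : ℝ≥0} (hs : ∀ n, T n ≠ s) :
    Tendsto x (𝓝[<] s) (𝓝 (x s)) :=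
  h.left_eq_self le_rfl hs ▸ h.tendsto_left le_rfl

theorem exists_bound (h : IsJumpPath A B l₀ l T X Y x) (b : ℝ≥0) :
    ∃ R, ∀ t ≤ b, ‖x t‖ ≤ R := by
  classical
  obtain ⟨R, hR⟩ := isCompact_Icc.exists_bound_of_continuousOn (h.continuousOn_contPart b)
  refine ⟨R + ∑ n ∈ h.events b, ‖jump B X Y n‖, fun t ht => ?_⟩
  rw [h.eq_contPart_add ht]
  refine (norm_add_le _ _).trans (add_le_add (hR t ⟨t.2, by exact_mod_cast ht⟩) ?_)
  refine (norm_sum_le _ _).trans (Finset.sum_le_sum fun n _ => ?_)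
  split_ifs <;> simp

/-- No event falls in a short interval just after s, so there the path is a translate of its
continuous part and inherits right continuity and right derivatives from it. -/
theorem eventually_eq_contPart_add (h : IsJumpPath A B l₀ l T X Y x) {b : ℝ≥0} {s : ℝ}
    (hs : s ∈ Set.Ico 0 (b : ℝ)) :
    ∃ v, ∀ᶠ r in 𝓝[≥] s, x r.toNNReal = contPart A l₀ l x r + v := by
  classical
  refine ⟨∑ n ∈ h.events b, if T n ≤ ENNReal.ofReal s then jump B X Y n else 0, ?_⟩
  have h1 : ∀ᶠ r in 𝓝[≥] s, ∀ n ∈ h.events b,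
      (T n ≤ ENNReal.ofReal r ↔ T n ≤ ENNReal.ofReal s) :=
    (Finset.eventually_all _).2 fun n _ => eventually_le_iff_le (T n) s
  have h2 : ∀ᶠ r : ℝ in 𝓝[≥] s, r < b := nhdsWithin_le_nhds (eventually_lt_nhds hs.2)
  filter_upwards [h1, h2, self_mem_nhdsWithin] with r hr hrb hrs
  have h3 : ((r.toNNReal : ℝ≥0) : ℝ) = r := Real.coe_toNNReal r (hs.1.trans hrs)
  rw [h.eq_contPart_add (t := r.toNNReal) (b := b) (Real.toNNReal_le_iff_le_coe.2 hrb.le), h3]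
  congr 1
  exact Finset.sum_congr rfl fun n hn => if_congr (hr n hn) rfl rfl

theorem continuousWithinAt_Ici (h : IsJumpPath A B l₀ l T X Y x) {b : ℝ≥0} {s : ℝ}
    (hs : s ∈ Set.Ico 0 (b : ℝ)) :
    ContinuousWithinAt (fun r : ℝ => x r.toNNReal) (Set.Ici s) s := by
  obtain ⟨v, hv⟩ := h.eventually_eq_contPart_add hs
  have hc : ContinuousWithinAt (contPart A l₀ l x) (Set.Ici s) s :=
    ((h.continuousOn_contPart b) s ⟨hs.1, hs.2.le⟩).mono_of_mem_nhdsWithin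
      (Filter.mem_of_superset (Icc_mem_nhdsGE hs.2) (Set.Icc_subset_Icc_left hs.1))
  exact (hc.add_const v).congr_of_eventuallyEq hv (hv.self_of_nhdsWithin Set.self_mem_Ici)

theorem stronglyMeasurableAtFilter {E : Type*} [NormedAddCommGroup E]
    {g : ℝ → E} {b s : ℝ} (hs : s ∈ Set.Ico 0 b) (hg : IntervalIntegrable g volume 0 b) :
    StronglyMeasurableAtFilter g (𝓝[>] s) volume := by
  refine AEStronglyMeasurable.stronglyMeasurableAtFilter_of_mem
    (s := Set.Ioc 0 b) ?_ ?_
  · exact (intervalIntegrable_iff_integrableOn_Ioc_of_le (hs.1.trans hs.2.le)).1 hg |>.1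
  · exact Filter.mem_of_superset (Ioc_mem_nhdsGT hs.2) (Set.Ioc_subset_Ioc_left hs.1)

theorem intervalIntegrable_mono_right {E : Type*} [NormedAddCommGroup E]
    {g : ℝ → E} {b s : ℝ} (hs : s ∈ Set.Icc 0 b) (hg : IntervalIntegrable g volume 0 b) :
    IntervalIntegrable g volume 0 s :=
  hg.mono_set (by
    rw [Set.uIcc_of_le hs.1, Set.uIcc_of_le (hs.1.trans hs.2)]
    exact Set.Icc_subset_Icc_right hs.2)

theorem hasDerivWithinAt (h : IsJumpPath A B l₀ l T X Y x) {b : ℝ≥0} {s : ℝ}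
    (hs : s ∈ Set.Ico 0 (b : ℝ)) :
    HasDerivWithinAt (fun r : ℝ => x r.toNNReal) (A.mulVec (x s.toNNReal - l₀)) (Set.Ici s) s := by
  obtain ⟨v, hv⟩ := h.eventually_eq_contPart_add hs
  have hi := h.intervalIntegrable_mulVec b
  have hcont : ContinuousWithinAt (fun u : ℝ => A.mulVec (x u.toNNReal - l₀)) (Set.Ioi s) s := by
    have hA : Continuous fun z : Fin d → ℝ => A.mulVec (z - l₀) := by fun_prop
    exact hA.continuousAt.comp_continuousWithinAt
      ((h.continuousWithinAt_Ici hs).mono Set.Ioi_subset_Ici_self)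
  have hd : HasDerivWithinAt (contPart A l₀ l x) (A.mulVec (x s.toNNReal - l₀)) (Set.Ici s) s :=
    (intervalIntegral.integral_hasDerivWithinAt_right
      (intervalIntegrable_mono_right ⟨hs.1, hs.2.le⟩ hi)
      (stronglyMeasurableAtFilter hs hi) hcont).const_add l
  exact (hd.add_const v).congr_of_eventuallyEq hv (hv.self_of_nhdsWithin Set.self_mem_Ici)

/-- On [0, b] the path is bounded, having a continuous part and finitely many jumps, so a continuous
G is evaluated on a compact set only. -/
theorem intervalIntegrable_comp (h : IsJumpPath A B l₀ l T X Y x) {G : ℝ → (Fin d → ℝ) → ℝ}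
    (hG : Continuous (Function.uncurry G)) (b : ℝ≥0) :
    IntervalIntegrable (fun s : ℝ => G s (x s.toNNReal)) volume 0 b := by
  obtain ⟨R, hR⟩ := h.exists_bound b
  obtain ⟨C, hC⟩ := (isCompact_Icc (a := (0 : ℝ)) (b := (b : ℝ))).prod
    (isCompact_closedBall (0 : Fin d → ℝ) R) |>.exists_bound_of_continuousOn hG.continuousOn
  rw [intervalIntegrable_iff_integrableOn_Ioc_of_le b.coe_nonneg]
  have hx := (intervalIntegrable_iff_integrableOn_Ioc_of_le b.coe_nonneg).1 (h.integrable_path b) |>.1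
  refine IntegrableOn.of_bound (C := C) (by simp) ?_ ?_
  · exact hG.comp_aestronglyMeasurable (aestronglyMeasurable_id.prodMk hx)
  · refine (ae_restrict_mem measurableSet_Ioc).mono fun s hs => ?_
    refine hC (s, x s.toNNReal) ⟨⟨hs.1.le, hs.2⟩, ?_⟩
    rw [mem_closedBall_zero_iff]
    exact hR _ (Real.toNNReal_le_iff_le_coe.2 hs.2)

theorem zero (h : IsJumpPath A B l₀ l T X Y x) : x 0 = l := by
  classical
  rw [h.eq_contPart_add (le_refl 0), Finset.sum_eq_zero]
  · simp [contPart]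
  · intro n _
    rw [if_neg]
    simpa using (h.time_pos n).ne'

open Classical in
/-- The change of variables formula along a path. -/
theorem energy_eq (h : IsJumpPath A B l₀ l T X Y x) {Φ q : (Fin d → ℝ) → ℝ}
    (hΦ : IsConcaveEnergy Φ q) (β : ℝ) (b : ℝ≥0) :
    Real.exp (β * b) * Φ (x b) = Φ l
      + (∫ s in (0 : ℝ)..b, Real.exp (β * s) * (β * Φ (x s.toNNReal) + q (x s.toNNReal)
          * (2 * (x s.toNNReal ⬝ᵥ A.mulVec (x s.toNNReal - l₀)))))
      + ∑ n ∈ h.events b, Real.exp (β * (T n).toReal)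
          * (Φ (x (T n).toNNReal) - Φ (h.left b (T n).toNNReal)) := by
  have hΦc := hΦ.continuous_energy
  have hqc := hΦ.continuous_slope
  set ψ : ℝ → ℝ := fun s => Real.exp (β * s) * (β * Φ (x s.toNNReal) + q (x s.toNNReal)
          * (2 * (x s.toNNReal ⬝ᵥ A.mulVec (x s.toNNReal - l₀)))) with hψ
  set a : ℕ → ℝ := fun n => Real.exp (β * (T n).toReal)
          * (Φ (x (T n).toNNReal) - Φ (h.left b (T n).toNNReal)) with ha
  -- The defect of the formula on [0, r]. Subtracting the jumps makes it continuous, and its right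
  -- derivative vanishes, so it is constant. Only right derivatives are available, because the drift
  -- ψ jumps with the path.
  set D : ℝ → ℝ := fun r => Real.exp (β * r) * Φ (x r.toNNReal) - (∫ s in (0 : ℝ)..r, ψ s)
      - ∑ n ∈ h.events b, if T n ≤ r.toNNReal then a n else 0 with hD
  have hψi : IntervalIntegrable ψ volume 0 b := by
    refine h.intervalIntegrable_comp (G := fun s z => Real.exp (β * s) * (β * Φ z + q z
          * (2 * (z ⬝ᵥ A.mulVec (z - l₀))))) ?_ b
    simp only [Function.uncurry_def]
    fun_prop
  have hψcont : ∀ s ∈ Set.Ico 0 (b : ℝ), ContinuousWithinAt ψ (Set.Ioi s) s := by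
    intro s hs
    have hG : Continuous fun z : ℝ × (Fin d → ℝ) => Real.exp (β * z.1) * (β * Φ z.2 + q z.2
          * (2 * (z.2 ⬝ᵥ A.mulVec (z.2 - l₀)))) := by fun_prop
    exact hG.continuousAt.comp_continuousWithinAt (f := fun r : ℝ => (r, x r.toNNReal))
      (continuousWithinAt_id.prodMk
        ((h.continuousWithinAt_Ici hs).mono Set.Ioi_subset_Ici_self))
  have hderiv : ∀ s ∈ Set.Ico 0 (b : ℝ), HasDerivWithinAt D 0 (Set.Ici s) s := by
    intro s hs
    have h1 : HasDerivWithinAt (fun r => Real.exp (β * r) * Φ (x r.toNNReal)) (ψ s)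
        (Set.Ici s) s := by
      have h2 := hΦ.hasDeriv _ _ s (h.hasDerivWithinAt hs)
      have h3 : HasDerivWithinAt (fun r : ℝ => Real.exp (β * r)) (Real.exp (β * s) * β)
          (Set.Ici s) s := by
        simpa using (((hasDerivAt_id s).const_mul β).exp).hasDerivWithinAt
      refine (h3.mul h2).congr_deriv ?_
      simp only [hψ]; ring
    have h2 : HasDerivWithinAt (fun r => ∫ s in (0 : ℝ)..r, ψ s) (ψ s) (Set.Ici s) s :=
      intervalIntegral.integral_hasDerivWithinAt_right
        (intervalIntegrable_mono_right ⟨hs.1, hs.2.le⟩ hψi)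
        (stronglyMeasurableAtFilter hs hψi) (hψcont s hs)
    have h3 : ∀ᶠ r in 𝓝[≥] s, ∀ n ∈ h.events b, (T n ≤ r.toNNReal ↔ T n ≤ s.toNNReal) :=
      (Finset.eventually_all _).2 fun n _ => eventually_le_iff_le (T n) s
    have h4 := ((h1.sub h2).sub_const
      (∑ n ∈ h.events b, if T n ≤ s.toNNReal then a n else 0))
    rw [sub_self] at h4
    refine h4.congr_of_eventuallyEq ?_ rfl
    filter_upwards [h3] with r hr
    simp only [hD]
    congr 1
    exact Finset.sum_congr rfl fun n hn => if_congr (hr n hn) rfl rfl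
  have hcont : ContinuousOn D (Set.Icc 0 b) := by
    intro s hs
    have hleft : ContinuousWithinAt D (Set.Icc 0 b ∩ Set.Iio s) s := by
      rcases hs.1.eq_or_lt with h0 | h0
      · subst h0
        have : Set.Icc 0 (b : ℝ) ∩ Set.Iio 0 = ∅ := by
          ext r; simp only [Set.mem_inter_iff, Set.mem_Icc, Set.mem_Iio, Set.mem_empty_iff_false,
            iff_false]; rintro ⟨⟨h1, _⟩, h2⟩; linarith
        simp [ContinuousWithinAt, this]
      lift s to ℝ≥0 using hs.1
      have hsb : s ≤ b := by exact_mod_cast hs.2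
      have htn : Tendsto Real.toNNReal (𝓝[<] (s : ℝ)) (𝓝[<] s) := by
        refine tendsto_nhdsWithin_iff.2 ⟨?_, ?_⟩
        · simpa using (continuous_real_toNNReal.tendsto (s : ℝ)).mono_left nhdsWithin_le_nhds
        · filter_upwards [self_mem_nhdsWithin] with r hr
          have h1 := (Real.toNNReal_lt_toNNReal_iff h0).2 hr
          rwa [Real.toNNReal_coe] at h1
      -- At an event time the summand `a n` entering the sum cancels the jump of the energy, so D
      -- takes the value computed from left limits; elsewhere nothing changes.
      have hval : D s = Real.exp (β * s) * Φ (h.left b s) - (∫ s in (0 : ℝ)..s, ψ s)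
          - ∑ n ∈ h.events b, if T n < s then a n else 0 := by
        simp only [hD, Real.toNNReal_coe]
        by_cases hn : ∃ n, T n = s
        · obtain ⟨n, hn⟩ := hn
          rw [h.sum_le_eq_sum_lt_add a hsb hn]
          simp only [ha, hn, ENNReal.coe_toReal, ENNReal.toNNReal_coe]
          ring
        · push Not at hn
          rw [h.sum_le_eq_sum_lt a hn, h.left_eq_self hsb hn]
      have hint : Tendsto (fun r => ∫ s in (0 : ℝ)..r, ψ s) (𝓝[Set.Icc 0 (b : ℝ) ∩ Set.Iio s] s)
          (𝓝 (∫ s in (0 : ℝ)..s, ψ s)) := by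
        have := intervalIntegral.continuousOn_primitive_interval (μ := volume) (f := ψ)
          (a := 0) (b := (b : ℝ)) (by
            rw [Set.uIcc_of_le b.coe_nonneg, ← intervalIntegrable_iff_integrableOn_Icc_of_le b.coe_nonneg]
            exact hψi)
        rw [Set.uIcc_of_le b.coe_nonneg] at this
        exact (this s hs).mono Set.inter_subset_left
      have hsub : 𝓝[Set.Icc 0 (b : ℝ) ∩ Set.Iio s] (s : ℝ) ≤ 𝓝[<] (s : ℝ) :=
        nhdsWithin_mono _ Set.inter_subset_right
      have hΦt : Tendsto (fun r : ℝ => Φ (x r.toNNReal)) (𝓝[<] (s : ℝ)) (𝓝 (Φ (h.left b s))) :=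
        (hΦc.tendsto _).comp ((h.tendsto_left hsb).comp htn)
      have hexp : Tendsto (fun r : ℝ => Real.exp (β * r)) (𝓝[<] (s : ℝ))
          (𝓝 (Real.exp (β * s))) :=
        (Continuous.tendsto (by fun_prop) _).mono_left nhdsWithin_le_nhds
      have hsum : ∀ᶠ r : ℝ in 𝓝[<] (s : ℝ), ∀ n ∈ h.events b, (T n ≤ r.toNNReal ↔ T n < s) :=
        htn.eventually ((Finset.eventually_all _).2 fun n _ => eventually_le_iff_lt (T n) s)
      rw [ContinuousWithinAt, hval]
      refine ((((hexp.mul hΦt).mono_left hsub).sub hint).sub_const _).congr' ?_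
      filter_upwards [hsub hsum] with r hr
      simp only [hD]
      congr 1
      exact Finset.sum_congr rfl fun n hn => (if_congr (hr n hn) rfl rfl).symm
    have hright : ContinuousWithinAt D (Set.Icc 0 b ∩ Set.Ici s) s := by
      rcases hs.2.eq_or_lt with h0 | h0
      · subst h0
        have : Set.Icc 0 (b : ℝ) ∩ Set.Ici (b : ℝ) = {(b : ℝ)} := by
          ext r
          simp only [Set.mem_inter_iff, Set.mem_Icc, Set.mem_Ici, Set.mem_singleton_iff]
          exact ⟨fun h1 => le_antisymm h1.1.2 h1.2, fun h1 => by subst h1; exact ⟨⟨b.coe_nonneg, le_rfl⟩, le_rfl⟩⟩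
        rw [this]
        exact continuousWithinAt_singleton
      · exact (hderiv s ⟨hs.1, h0⟩).continuousWithinAt.mono Set.inter_subset_right
    have := hleft.union hright
    rwa [← Set.inter_union_distrib_left, Set.Iio_union_Ici, Set.inter_univ] at this
  have hconst := constant_of_has_deriv_right_zero hcont hderiv b ⟨b.coe_nonneg, le_rfl⟩
  have h0 : D 0 = Φ l := by
    have : ∀ n, ¬ T n ≤ 0 := fun n => not_le.2 (h.time_pos n)
    simp [hD, this, h.zero]
  have hb : D b = Real.exp (β * b) * Φ (x b) - (∫ s in (0 : ℝ)..b, ψ s)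
      - ∑ n ∈ h.events b, a n := by
    simp only [hD, Real.toNNReal_coe]
    congr 1
    exact Finset.sum_congr rfl fun n hn => if_pos (h.mem_events.1 hn)
  rw [hb, h0] at hconst
  linarith

/-- The change of variables inequality for concave functions of `x ⬝ᵥ x`. -/
theorem energy_le (h : IsJumpPath A B l₀ l T X Y x) {Φ q : (Fin d → ℝ) → ℝ}
    (hΦ : IsConcaveEnergy Φ q) (β : ℝ) (b : ℝ≥0) {z : ℝ≥0 → Fin d → ℝ}
    (hz : ∀ s, 0 < s → Tendsto x (𝓝[<] s) (𝓝 (z s))) :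
    Real.exp (β * b) * Φ (x b) ≤ Φ l
      + (∫ s in (0 : ℝ)..b, Real.exp (β * s) * (β * Φ (x s.toNNReal) + q (x s.toNNReal)
          * (2 * (x s.toNNReal ⬝ᵥ A.mulVec (x s.toNNReal - l₀)))))
      + ∑ n ∈ h.events b, Real.exp (β * (T n).toReal) * (q (z (T n).toNNReal)
          * (2 * (z (T n).toNNReal ⬝ᵥ B.col (X n)) * Y n (X n)
            + (B.col (X n) ⬝ᵥ B.col (X n)) * Y n (X n) ^ 2)) := by
  rw [h.energy_eq hΦ β b]
  gcongr with n hn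
  have hTn : T n ≠ ∞ := ((h.mem_events.1 hn).trans_lt ENNReal.coe_lt_top).ne
  set s := (T n).toNNReal with hs
  have hTs : T n = s := (ENNReal.coe_toNNReal hTn).symm
  have hs0 : 0 < s := by
    have := h.time_pos n
    rw [hTs] at this
    exact_mod_cast this
  have hsb : s ≤ b := by
    have := h.mem_events.1 hn
    rw [hTs] at this
    exact_mod_cast this
  have : (𝓝[<] s).NeBot := nhdsLT_neBot_of_exists_lt ⟨0, hs0⟩
  have hzs : h.left b s = z s := tendsto_nhds_unique (h.tendsto_left hsb) (hz s hs0)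
  -- The tangent is taken at the left limit: the coefficients then depend only on the state before
  -- the jump, and the size enters through its first two powers alone.
  have h1 := hΦ.tangent (z s) (x s)
  rw [hzs]
  have h2 : x s ⬝ᵥ x s - z s ⬝ᵥ z s = 2 * (z s ⬝ᵥ B.col (X n)) * Y n (X n)
      + (B.col (X n) ⬝ᵥ B.col (X n)) * Y n (X n) ^ 2 := by
    rw [h.eq_left_add_jump hsb hTs, hzs, jump]
    simp only [dotProduct_add, add_dotProduct, dotProduct_smul, smul_dotProduct, smul_eq_mul]
    rw [dotProduct_comm (B.col (X n)) (z s)]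
    ring
  rw [h2] at h1
  linarith

end IsJumpPath

/-! ### Predictable left limits along a grid -/

/-- The largest multiple of `1 / (n + 1)` that is strictly smaller than `s` (and `0` for `s = 0`). -/
noncomputable def gridLeft (n : ℕ) (s : ℝ≥0) : ℝ≥0 :=
  ((⌈s * (n + 1)⌉₊ - 1 : ℕ) : ℝ≥0) / (n + 1)

theorem gridLeft_zero (n : ℕ) : gridLeft n 0 = 0 := by simp [gridLeft]

theorem exists_ceil_eq_succ (n : ℕ) {s : ℝ≥0} (hs : 0 < s) :
    ∃ j : ℕ, s ∈ Set.Ioc ((j : ℝ≥0) / (n + 1)) ((j + 1 : ℕ) / (n + 1)) := by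
  have hn : (0 : ℝ≥0) < n + 1 := by positivity
  have h1 : 0 < ⌈s * (n + 1)⌉₊ := Nat.ceil_pos.2 (mul_pos hs hn)
  refine ⟨⌈s * (n + 1)⌉₊ - 1, ?_⟩
  have h2 := (Nat.ceil_eq_iff h1.ne').1 (rfl : ⌈s * (n + 1)⌉₊ = _)
  rw [Nat.sub_add_cancel h1]
  exact ⟨(div_lt_iff₀ hn).2 h2.1, (le_div_iff₀ hn).2 h2.2⟩

theorem gridLeft_eq {n j : ℕ} {s : ℝ≥0}
    (hs : s ∈ Set.Ioc ((j : ℝ≥0) / (n + 1)) ((j + 1 : ℕ) / (n + 1))) :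
    gridLeft n s = (j : ℝ≥0) / (n + 1) := by
  have hn : (0 : ℝ≥0) < n + 1 := by positivity
  have h1 : ⌈s * (n + 1)⌉₊ = j + 1 := by
    refine (Nat.ceil_eq_iff (Nat.succ_ne_zero j)).2 ⟨?_, ?_⟩
    · simpa using (div_lt_iff₀ hn).1 hs.1
    · simpa using (le_div_iff₀ hn).1 hs.2
  rw [gridLeft, h1, Nat.add_sub_cancel]

theorem gridLeft_lt (n : ℕ) {s : ℝ≥0} (hs : 0 < s) : gridLeft n s < s := by
  obtain ⟨j, hj⟩ := exists_ceil_eq_succ n hs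
  exact gridLeft_eq hj ▸ hj.1

theorem le_gridLeft_add (n : ℕ) {s : ℝ≥0} (hs : 0 < s) : s ≤ gridLeft n s + 1 / (n + 1) := by
  obtain ⟨j, hj⟩ := exists_ceil_eq_succ n hs
  rw [gridLeft_eq hj, ← add_div]
  exact_mod_cast hj.2

theorem tendsto_gridLeft {s : ℝ≥0} (hs : 0 < s) :
    Tendsto (fun n => gridLeft n s) atTop (𝓝[<] s) := by
  refine tendsto_nhdsWithin_iff.2 ⟨?_, Eventually.of_forall fun n => gridLeft_lt n hs⟩
  have h1 : Tendsto (fun n : ℕ => s - 1 / ((n : ℝ≥0) + 1)) atTop (𝓝 s) := by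
    have := (tendsto_const_nhds (x := s)).sub (tendsto_one_div_add_atTop_nhds_zero_nat (𝕜 := ℝ≥0))
    simpa using this
  exact tendsto_of_tendsto_of_tendsto_of_le_of_le h1 tendsto_const_nhds
    (fun n => tsub_le_iff_right.2 (le_gridLeft_add n hs)) (fun n => (gridLeft_lt n hs).le)

/-- A version of the left limits of the process `u` with values in `{x | l₀ ≤ x}`. -/
noncomputable def leftVersion {Ω : Type*} {d : ℕ} (l₀ : Fin d → ℝ) (u : ℝ≥0 → Ω → Fin d → ℝ) (s : ℝ≥0) (ω : Ω) :
    Fin d → ℝ :=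
  limUnder atTop (fun n => u (gridLeft n s) ω) ⊔ l₀

/-- The supremum with λ₀ secures this for every s and ω, even where the sampled limit fails to
exist, so the moment hypotheses on the kernels apply without exceptional sets. -/
theorem le_leftVersion {Ω : Type*} {d : ℕ} (l₀ : Fin d → ℝ) (u : ℝ≥0 → Ω → Fin d → ℝ) (s : ℝ≥0) (ω : Ω) :
    l₀ ≤ leftVersion l₀ u s ω := le_sup_right

section Predictable

variable {Ω : Type*} [mΩ : MeasurableSpace Ω] {𝓕 : Filtration ℝ≥0 mΩ}

theorem predictable_le_prod : 𝓕.predictable ≤ (inferInstance : MeasurableSpace (ℝ≥0 × Ω)) := by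
  refine measurableSpace_le_predictable_of_measurableSet (fun A hA => ?_) fun i A hA => ?_
  · exact (measurableSet_singleton _).prod (𝓕.le _ _ hA)
  · exact measurableSet_Ioi.prod (𝓕.le _ _ hA)

theorem measurable_fst_predictable : Measurable[𝓕.predictable] (Prod.fst : ℝ≥0 × Ω → ℝ≥0) := by
  let := 𝓕.predictable
  refine measurable_of_Ioi fun i => ?_
  have : Prod.fst ⁻¹' Set.Ioi i = Set.Ioi i ×ˢ (Set.univ : Set Ω) := by ext; simp
  rw [this]
  exact measurableSet_predictable_Ioi_prod MeasurableSet.univ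

/-- On each left-open grid cell the value is that of u at the left endpoint, hence known before the
cell begins. The preimage is a countable union of predictable rectangles and a slice at time 0. -/
theorem measurable_gridLeft {E : Type*} [MeasurableSpace E] {u : ℝ≥0 → Ω → E} (hu : Adapted 𝓕 u)
    (n : ℕ) : Measurable[𝓕.predictable] fun z : ℝ≥0 × Ω => u (gridLeft n z.1) z.2 := by
  let := 𝓕.predictable
  intro S hS
  have : (fun z : ℝ≥0 × Ω => u (gridLeft n z.1) z.2) ⁻¹' S
      = ({⊥} ×ˢ (u 0 ⁻¹' S)) ∪ ⋃ j : ℕ, Set.Ioc ((j : ℝ≥0) / (n + 1)) ((j + 1 : ℕ) / (n + 1))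
          ×ˢ (u ((j : ℝ≥0) / (n + 1)) ⁻¹' S) := by
    ext ⟨s, ω⟩
    simp only [Set.mem_preimage, Set.mem_union, Set.mem_prod, Set.mem_singleton_iff,
      Set.mem_iUnion, bot_eq_zero']
    constructor
    · intro h
      rcases eq_zero_or_pos s with rfl | hs
      · rw [gridLeft_zero] at h
        exact Or.inl ⟨rfl, h⟩
      · obtain ⟨j, hj⟩ := exists_ceil_eq_succ n hs
        rw [gridLeft_eq hj] at h
        exact Or.inr ⟨j, hj, h⟩
    · rintro (⟨rfl, h⟩ | ⟨j, hj, h⟩)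
      · rwa [gridLeft_zero]
      · rwa [gridLeft_eq hj]
  rw [this]
  exact (measurableSet_predictable_singleton_bot_prod (hu 0 hS)).union
    (MeasurableSet.iUnion fun j => measurableSet_predictable_Ioc_prod _ _ (hu _ hS))

theorem measurable_leftVersion_predictable {d : ℕ} (l₀ : Fin d → ℝ) {u : ℝ≥0 → Ω → Fin d → ℝ}
    (hu : Adapted 𝓕 u) :
    Measurable[𝓕.predictable] fun z : ℝ≥0 × Ω => leftVersion l₀ u z.1 z.2 := by
  let := 𝓕.predictable
  have h1 : Measurable fun z : ℝ≥0 × Ω => limUnder atTop (fun n => u (gridLeft n z.1) z.2) :=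
    (StronglyMeasurable.limUnder
      fun n => (measurable_gridLeft hu n).stronglyMeasurable).measurable
  exact measurable_pi_iff.2 fun i => ((measurable_pi_apply i).comp h1).sup measurable_const

theorem isStronglyPredictable_comp {d : ℕ} (l₀ : Fin d → ℝ) {u : ℝ≥0 → Ω → Fin d → ℝ}
    (hu : Adapted 𝓕 u) {E : Type*} [TopologicalSpace E] [TopologicalSpace.PseudoMetrizableSpace E]
    [SecondCountableTopology E] [MeasurableSpace E] [BorelSpace E]
    {G : ℝ≥0 → (Fin d → ℝ) → E} (hG : Measurable (Function.uncurry G)) :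
    IsStronglyPredictable 𝓕 fun s ω => G s (leftVersion l₀ u s ω) := by
  have h1 : Measurable[𝓕.predictable] fun z : ℝ≥0 × Ω => G z.1 (leftVersion l₀ u z.1 z.2) := by
    let := 𝓕.predictable
    exact hG.comp (measurable_fst_predictable.prodMk (measurable_leftVersion_predictable l₀ hu))
  let := 𝓕.predictable
  exact h1.stronglyMeasurable

theorem measurable_leftVersion {d : ℕ} (l₀ : Fin d → ℝ) {u : ℝ≥0 → Ω → Fin d → ℝ}
    (hu : Adapted 𝓕 u) : Measurable fun z : ℝ≥0 × Ω => leftVersion l₀ u z.1 z.2 :=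
  (measurable_leftVersion_predictable l₀ hu).mono predictable_le_prod le_rfl

theorem measurable_of_isStronglyPredictable {E : Type*} [TopologicalSpace E]
    [TopologicalSpace.PseudoMetrizableSpace E] [MeasurableSpace E] [BorelSpace E]
    {H : ℝ≥0 → Ω → E} (hH : IsStronglyPredictable 𝓕 H) : Measurable (Function.uncurry H) :=
  Measurable.mono (by let := 𝓕.predictable; exact StronglyMeasurable.measurable hH)
    (predictable_le_prod (𝓕 := 𝓕)) le_rfl

end Predictable

/-! ### Left limits of the intensity process -/

namespace IsLinearModel

variable {d : ℕ} {A B : Matrix (Fin d) (Fin d) ℝ} {l₀ l : Fin d → ℝ}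
    {ν : Fin d → Kernel (Fin d → ℝ) ℝ}
    {Ω : Type*} [mΩ : MeasurableSpace Ω] {P : Measure Ω} {𝓕 : Filtration ℝ≥0 mΩ}
    {T : ℕ → Ω → ℝ≥0∞} {X : ℕ → Ω → Fin d} {Y : ℕ → Fin d → Ω → ℝ}
    {lam : ℝ≥0 → Ω → Fin d → ℝ}

theorem ae_isJumpPath (h : IsLinearModel A B l₀ ν l P 𝓕 T X Y lam) :
    ∀ᵐ ω ∂P, IsJumpPath A B l₀ l (fun n => T n ω) (fun n => X n ω) (fun n k => Y n k ω)
      (fun t => lam t ω) := by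
  filter_upwards [h.nonexplosive, h.integrable_path, h.equation] with ω h1 h2 h3
  exact ⟨fun n => h.time_pos n ω, fun n => h.time_lt n ω, h.time_mono ω, h1, h2, h3⟩

/-- Grid points approach s strictly from below, so they find the left limit. It lies in the closed
state space, hence the supremum with λ₀ changes nothing. -/
theorem ae_tendsto_leftVersion (h : IsLinearModel A B l₀ ν l P 𝓕 T X Y lam) :
    ∀ᵐ ω ∂P, ∀ s, 0 < s → Tendsto (fun t => lam t ω) (𝓝[<] s) (𝓝 (leftVersion l₀ lam s ω)) := by
  filter_upwards [h.ae_isJumpPath, h.mem_state] with ω hp hst s hs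
  have h1 := hp.tendsto_left (le_refl s)
  have h2 := h1.comp (tendsto_gridLeft hs)
  have h3 : l₀ ≤ hp.left s s := ge_of_tendsto' h2 fun n => hst _
  have h4 : leftVersion l₀ lam s ω = hp.left s s := by
    rw [leftVersion, sup_eq_left.2]
    · exact h2.limUnder_eq
    · exact h3.trans_eq h2.limUnder_eq.symm
  rwa [h4]

/-- The path can differ from its left limit only at the countably many event times, a Lebesgue null
set. -/
theorem ae_eq_leftVersion (h : IsLinearModel A B l₀ ν l P 𝓕 T X Y lam) :
    ∀ᵐ ω ∂P, ∀ᵐ s : ℝ ∂volume.restrict (Set.Ioi 0),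
      lam s.toNNReal ω = leftVersion l₀ lam s.toNNReal ω := by
  filter_upwards [h.ae_isJumpPath, h.ae_tendsto_leftVersion] with ω hp hl
  have hc : (Set.range fun n => (T n ω).toReal).Countable := Set.countable_range _
  filter_upwards [ae_restrict_mem measurableSet_Ioi,
    ae_restrict_of_ae (hc.ae_notMem volume)] with s hs hsT
  have hs0 : 0 < s.toNNReal := Real.toNNReal_pos.2 hs
  have : (𝓝[<] s.toNNReal).NeBot := nhdsLT_neBot_of_exists_lt ⟨0, hs0⟩
  refine tendsto_nhds_unique (hp.tendsto_self_of_ne fun n hn => hsT ⟨n, ?_⟩) (hl _ hs0)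
  simp only [hn, ENNReal.coe_toReal, Real.coe_toNNReal s (le_of_lt hs)]

theorem measurable_intensity (h : IsLinearModel A B l₀ ν l P 𝓕 T X Y lam) (t : ℝ≥0) :
    Measurable (lam t) :=
  (h.adapted_intensity t).mono (𝓕.le t) le_rfl

end IsLinearModel
-- Compensator formulas
namespace IsLinearModel

variable {d : ℕ} {A B : Matrix (Fin d) (Fin d) ℝ} {l₀ l : Fin d → ℝ}
    {ν : Fin d → Kernel (Fin d → ℝ) ℝ}
    {Ω : Type*} [mΩ : MeasurableSpace Ω] {P : Measure Ω} {𝓕 : Filtration ℝ≥0 mΩ}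
    {T : ℕ → Ω → ℝ≥0∞} {X : ℕ → Ω → Fin d} {Y : ℕ → Fin d → Ω → ℝ}
    {lam : ℝ≥0 → Ω → Fin d → ℝ}

theorem measurable_at_time (h : IsLinearModel A B l₀ ν l P 𝓕 T X Y lam) {E : Type*}
    [MeasurableSpace E] {H : ℝ≥0 → Ω → E} (hH : Measurable (Function.uncurry H)) (n : ℕ) :
    Measurable fun ω => H (T n ω).toNNReal ω :=
  hH.comp ((h.measurable_time n).ennreal_toNNReal.prodMk measurable_id)

theorem measurableSet_event (h : IsLinearModel A B l₀ ν l P 𝓕 T X Y lam) (n : ℕ) (k : Fin d) :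
    MeasurableSet {ω | X n ω = k ∧ T n ω < ∞} :=
  (measurableSet_eq_fun (h.measurable_type n) measurable_const).inter
    (measurableSet_lt (h.measurable_time n) measurable_const)

/-- The law of the sizes, for functions in place of sets. -/
theorem lintegral_size (h : IsLinearModel A B l₀ ν l P 𝓕 T X Y lam) (n : ℕ) (k : Fin d)
    {H : ℝ≥0 → Ω → ℝ≥0∞} (hH : IsStronglyPredictable 𝓕 H) {g : ℝ → ℝ≥0∞} (hg : Measurable g) :
    ∫⁻ ω in {ω | X n ω = k ∧ T n ω < ∞}, H (T n ω).toNNReal ω * g (Y n k ω) ∂P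
      = ∫⁻ ω in {ω | X n ω = k ∧ T n ω < ∞}, H (T n ω).toNNReal ω *
          ∫⁻ y, g y ∂(ν k (leftVersion l₀ lam (T n ω).toNNReal ω)) ∂P := by
  have hHm := h.measurable_at_time (measurable_of_isStronglyPredictable hH) n
  have hΛ : Measurable fun ω => leftVersion l₀ lam (T n ω).toNNReal ω :=
    h.measurable_at_time (H := fun s ω => leftVersion l₀ lam s ω)
      (measurable_leftVersion l₀ h.adapted_intensity) n
  have hνΛ : Measurable fun ω => ν k (leftVersion l₀ lam (T n ω).toNNReal ω) :=
    (ν k).measurable.comp hΛ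
  set E := {ω | X n ω = k ∧ T n ω < ∞} with hE
  have hEm : MeasurableSet E := h.measurableSet_event n k
  set μ := (P.restrict E).withDensity fun ω => H (T n ω).toNNReal ω with hμ
  have hwd : ∀ F : Ω → ℝ≥0∞, Measurable F →
      ∫⁻ ω, F ω ∂μ = ∫⁻ ω in E, H (T n ω).toNNReal ω * F ω ∂P := fun F hF =>
    lintegral_withDensity_eq_lintegral_mul _ hHm hF
  -- With H absorbed into the measure, the size law says that the image of μ under the size and the
  -- mixture of the kernels agree on Borel sets. Equality of measures then allows any nonnegative g.
  have key : μ.map (Y n k)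
      = μ.bind fun ω => ν k (leftVersion l₀ lam (T n ω).toNNReal ω) := by
    ext S hS
    have hYS : MeasurableSet (Y n k ⁻¹' S) := h.measurable_size n k hS
    rw [Measure.map_apply (h.measurable_size n k) hS, Measure.bind_apply hS hνΛ.aemeasurable,
      hwd (fun ω => ν k (leftVersion l₀ lam (T n ω).toNNReal ω) S)
        ((Measure.measurable_coe hS).comp hνΛ), hμ, withDensity_apply _ hYS,
      Measure.restrict_restrict hYS]
    have h1 := h.size_law n k S hS H hH
    have h2 : Y n k ⁻¹' S ∩ E = {ω | X n ω = k ∧ T n ω < ∞ ∧ Y n k ω ∈ S} := by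
      ext ω; simp only [hE, Set.mem_inter_iff, Set.mem_preimage, Set.mem_ofPred_eq]; tauto
    rw [h2, h1]
    refine lintegral_congr_ae ?_
    filter_upwards [ae_restrict_of_ae h.ae_tendsto_leftVersion, ae_restrict_mem hEm] with ω hl hω
    have h0 : 0 < (T n ω).toNNReal := ENNReal.toNNReal_pos (h.time_pos n ω).ne' hω.2.ne
    have : (𝓝[<] (T n ω).toNNReal).NeBot := nhdsLT_neBot_of_exists_lt ⟨0, h0⟩
    rw [leftLim_eq_of_tendsto (hl _ h0)]
  have h1 : ∫⁻ y, g y ∂(μ.map (Y n k)) = ∫⁻ ω in E, H (T n ω).toNNReal ω * g (Y n k ω) ∂P := by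
    rw [lintegral_map hg (h.measurable_size n k), hwd (fun ω => g (Y n k ω)) (hg.comp (h.measurable_size n k))]
  have h2 : Measurable fun ω => ∫⁻ y, g y ∂(ν k (leftVersion l₀ lam (T n ω).toNNReal ω)) :=
    (Measure.measurable_lintegral hg).comp hνΛ
  rw [← h1, key, Measure.lintegral_bind hνΛ.aemeasurable hg.aemeasurable, hwd _ h2]

/-- The compensator formula for nonnegative integrands. -/
theorem lintegral_tsum_size (h : IsLinearModel A B l₀ ν l P 𝓕 T X Y lam) (k : Fin d)
    {H : ℝ≥0 → Ω → ℝ≥0∞} (hH : IsStronglyPredictable 𝓕 H) {g : ℝ → ℝ≥0∞} (hg : Measurable g) :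
    ∫⁻ ω, ∑' n, {ω | X n ω = k ∧ T n ω < ∞}.indicator
        (fun ω => H (T n ω).toNNReal ω * g (Y n k ω)) ω ∂P
      = ∫⁻ ω, (∫⁻ s in Set.Ici (0 : ℝ), H s.toNNReal ω
          * (∫⁻ y, g y ∂(ν k (leftVersion l₀ lam s.toNNReal ω)))
          * ENNReal.ofReal (lam s.toNNReal ω k)) ∂P := by
  have hK : IsStronglyPredictable 𝓕 fun (s : ℝ≥0) ω => H s ω
      * ∫⁻ y, g y ∂(ν k (leftVersion l₀ lam s ω)) := by
    have h1 : IsStronglyPredictable 𝓕 fun (s : ℝ≥0) ω =>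
        ∫⁻ y, g y ∂(ν k (leftVersion l₀ lam s ω)) :=
      isStronglyPredictable_comp l₀ h.adapted_intensity
        (G := fun _ x => ∫⁻ y, g y ∂(ν k x))
        ((Measure.measurable_lintegral hg).comp ((ν k).measurable.comp measurable_snd))
    let := 𝓕.predictable
    have h2 := (StronglyMeasurable.measurable hH).mul (StronglyMeasurable.measurable h1)
    exact h2.stronglyMeasurable
  -- Averaging g over the kernel at the left limit leaves a predictable integrand, to which the
  -- intensity identity applies; the size law then matches the two sums event by event.
  rw [← h.intensity k _ hK]
  have hHm := fun n => h.measurable_at_time (measurable_of_isStronglyPredictable hH) n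
  have hKm := fun n => h.measurable_at_time (measurable_of_isStronglyPredictable hK) n
  have h3 : ∀ ω, integralCounting T X k
      (fun (s : ℝ≥0) ω => H s ω * ∫⁻ y, g y ∂(ν k (leftVersion l₀ lam s ω))) ω
      = ∑' n, {ω | X n ω = k ∧ T n ω < ∞}.indicator (fun ω => H (T n ω).toNNReal ω
          * ∫⁻ y, g y ∂(ν k (leftVersion l₀ lam (T n ω).toNNReal ω))) ω := fun ω => by
    simp only [integralCounting, Set.indicator_apply, Set.mem_ofPred_eq]
  simp only [h3]
  have hHg : ∀ n, Measurable fun ω => H (T n ω).toNNReal ω * g (Y n k ω) := fun n =>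
    (hHm n).mul (hg.comp (h.measurable_size n k))
  rw [lintegral_tsum fun n => ((hHg n).indicator (h.measurableSet_event n k)).aemeasurable,
    lintegral_tsum fun n => ((hKm n).indicator (h.measurableSet_event n k)).aemeasurable]
  congr 1
  funext n
  rw [lintegral_indicator (h.measurableSet_event n k),
    lintegral_indicator (h.measurableSet_event n k), h.lintegral_size n k hH hg]

/-- The compensator formula for nonnegative integrands on a bounded time interval. -/
theorem lintegral_tsum_size_le [SFinite P] (h : IsLinearModel A B l₀ ν l P 𝓕 T X Y lam) (t : ℝ≥0)
    (k : Fin d) {H : ℝ≥0 → Ω → ℝ≥0∞} (hH : IsStronglyPredictable 𝓕 H) {g : ℝ → ℝ≥0∞}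
    (hg : Measurable g) :
    ∫⁻ ω, ∑' n, {ω | X n ω = k ∧ T n ω ≤ t}.indicator
        (fun ω => H (T n ω).toNNReal ω * g (Y n k ω)) ω ∂P
      = ∫⁻ z, H z.2.toNNReal z.1
          * (∫⁻ y, g y ∂(ν k (leftVersion l₀ lam z.2.toNNReal z.1)))
          * ENNReal.ofReal (leftVersion l₀ lam z.2.toNNReal z.1 k)
            ∂(P.prod (volume.restrict (Set.Ioc 0 (t : ℝ)))) := by
  have hH' : IsStronglyPredictable 𝓕 fun s ω => (Set.Iic t).indicator (fun s => H s ω) s := by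
    let := 𝓕.predictable
    have h1 : MeasurableSet ((Prod.fst : ℝ≥0 × Ω → ℝ≥0) ⁻¹' Set.Iic t) :=
      measurable_fst_predictable measurableSet_Iic
    exact ((StronglyMeasurable.measurable hH).indicator h1).stronglyMeasurable
  have h1 := h.lintegral_tsum_size k hH' hg
  have h2 : ∀ ω n, {ω | X n ω = k ∧ T n ω < ∞}.indicator
        (fun ω => (Set.Iic t).indicator (fun s => H s ω) (T n ω).toNNReal * g (Y n k ω)) ω
      = {ω | X n ω = k ∧ T n ω ≤ t}.indicator
        (fun ω => H (T n ω).toNNReal ω * g (Y n k ω)) ω := by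
    intro ω n
    simp only [Set.indicator_apply, Set.mem_ofPred_eq, Set.mem_Iic]
    by_cases hT : T n ω = ∞
    · simp [hT]
    · have h3 : (T n ω).toNNReal ≤ t ↔ T n ω ≤ t := by
        rw [← ENNReal.coe_le_coe, ENNReal.coe_toNNReal hT]
      simp only [h3, lt_top_iff_ne_top.2 hT, and_true]
      by_cases hX : X n ω = k <;> by_cases ht : T n ω ≤ t <;> simp [hX, ht]
  simp only [h2] at h1
  rw [h1, lintegral_prod]
  · refine lintegral_congr_ae ?_
    filter_upwards [h.ae_eq_leftVersion] with ω hω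
    rw [restrict_Ioi_eq_restrict_Ici.symm]
    have h4 : Set.Ioc (0 : ℝ) t = Set.Iic (t : ℝ) ∩ Set.Ioi 0 := by
      ext s; simp [and_comm]
    rw [h4, ← Measure.restrict_restrict measurableSet_Iic, ← lintegral_indicator measurableSet_Iic]
    refine lintegral_congr_ae ?_
    filter_upwards [hω] with s hs
    simp only [Set.indicator_apply, Set.mem_Iic, Real.toNNReal_le_iff_le_coe, hs]
    split_ifs <;> simp
  · have hsw : Measurable fun z : Ω × ℝ => (z.2.toNNReal, z.1) := by fun_prop
    have hΛ := (measurable_leftVersion l₀ h.adapted_intensity).comp hsw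
    refine Measurable.aemeasurable (Measurable.mul (Measurable.mul ?_ ?_) ?_)
    · exact (measurable_of_isStronglyPredictable hH).comp hsw
    · exact (Measure.measurable_lintegral hg).comp ((ν k).measurable.comp hΛ)
    · exact ((measurable_pi_apply k).comp hΛ).ennreal_ofReal

/-- The kernels are not assumed to be carried by [0, ∞), only the sizes are nonnegative. The
compensator formula for the indicator of (-∞, 0) shows that, almost everywhere, either the kernel at
the current state charges no negative sizes or the rate of type k vanishes. In the latter case both
sides are 0. -/
theorem ae_lintegral_size_eq [SFinite P] (h : IsLinearModel A B l₀ ν l P 𝓕 T X Y lam)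
    (hl₀ : 0 ≤ l₀) (t : ℝ≥0)
    (k : Fin d) {g : ℝ → ℝ} (hg0 : ∀ y, 0 ≤ y → 0 ≤ g y)
    (hgi : ∀ x, l₀ ≤ x → Integrable g (ν k x)) :
    ∀ᵐ z ∂(P.prod (volume.restrict (Set.Ioc 0 (t : ℝ)))),
      0 ≤ leftVersion l₀ lam z.2.toNNReal z.1 k
          * ∫ y, g y ∂(ν k (leftVersion l₀ lam z.2.toNNReal z.1)) ∧
      (∫⁻ y, ENNReal.ofReal (g y) ∂(ν k (leftVersion l₀ lam z.2.toNNReal z.1)))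
          * ENNReal.ofReal (leftVersion l₀ lam z.2.toNNReal z.1 k)
      = ENNReal.ofReal (leftVersion l₀ lam z.2.toNNReal z.1 k
          * ∫ y, g y ∂(ν k (leftVersion l₀ lam z.2.toNNReal z.1))) := by
  have hsw : Measurable fun z : Ω × ℝ => (z.2.toNNReal, z.1) := by fun_prop
  have hΛ := (measurable_leftVersion l₀ h.adapted_intensity).comp hsw
  have h1 : ∫⁻ z, ν k (leftVersion l₀ lam z.2.toNNReal z.1) (Set.Iio 0)
      * ENNReal.ofReal (leftVersion l₀ lam z.2.toNNReal z.1 k)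
        ∂(P.prod (volume.restrict (Set.Ioc 0 (t : ℝ)))) = 0 := by
    have h1 := h.lintegral_tsum_size_le t k (H := fun _ _ => 1)
      (isStronglyPredictable_comp l₀ h.adapted_intensity (G := fun _ _ => (1 : ℝ≥0∞))
        measurable_const)
      (g := (Set.Iio 0).indicator 1) (measurable_one.indicator measurableSet_Iio)
    have h2 : ∀ ω n, {ω | X n ω = k ∧ T n ω ≤ t}.indicator
        (fun ω => (Set.Iio (0 : ℝ)).indicator (1 : ℝ → ℝ≥0∞) (Y n k ω)) ω = 0 := by
      intro ω n
      simp [Set.indicator_apply, not_lt.2 (h.size_nonneg n k ω)]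
    simp only [one_mul, h2, tsum_zero, lintegral_zero, lintegral_indicator_one measurableSet_Iio]
      at h1
    exact h1.symm
  have hm : Measurable fun z : Ω × ℝ => ν k (leftVersion l₀ lam z.2.toNNReal z.1) (Set.Iio 0)
      * ENNReal.ofReal (leftVersion l₀ lam z.2.toNNReal z.1 k) :=
    ((Measure.measurable_coe measurableSet_Iio).comp ((ν k).measurable.comp hΛ)).mul
      ((measurable_pi_apply k).comp hΛ).ennreal_ofReal
  have h3 := (lintegral_eq_zero_iff hm).1 h1
  filter_upwards [h3] with z hz
  set x := leftVersion l₀ lam z.2.toNNReal z.1 with hx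
  have hlx : l₀ ≤ x := le_leftVersion _ _ _ _
  rcases mul_eq_zero.1 hz with h4 | h4
  · have h5 : 0 ≤ᵐ[ν k x] g := by
      have : ∀ᵐ y ∂(ν k x), y ∉ Set.Iio (0 : ℝ) := measure_eq_zero_iff_ae_notMem.1 h4
      filter_upwards [this] with y hy
      exact hg0 y (not_lt.1 hy)
    refine ⟨mul_nonneg ((hl₀ k).trans (hlx k)) (integral_nonneg_of_ae h5), ?_⟩
    rw [← ofReal_integral_eq_lintegral_ofReal (hgi x hlx) h5,
      ENNReal.ofReal_mul ((hl₀ k).trans (hlx k)), mul_comm]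
  · have h6 : x k = 0 := le_antisymm (ENNReal.ofReal_eq_zero.1 h4) ((hl₀ k).trans (hlx k))
    simp [h6]

theorem ae_summable_size [SFinite P] (h : IsLinearModel A B l₀ ν l P 𝓕 T X Y lam) (t : ℝ≥0)
    (k : Fin d) (a : ℕ → Ω → ℝ) :
    ∀ᵐ ω ∂P, Summable fun n => {ω | X n ω = k ∧ T n ω ≤ t}.indicator (a n) ω := by
  filter_upwards [h.nonexplosive] with ω hω
  refine summable_of_hasFiniteSupport ((hω t).subset fun n hn => ?_)
  by_contra h1
  exact hn (Set.indicator_of_notMem (fun h2 => h1 h2.2) _)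

/-- The compensator formula for real integrands on a bounded time interval. -/
theorem integral_tsum_size [SFinite P] (h : IsLinearModel A B l₀ ν l P 𝓕 T X Y lam)
    (hl₀ : 0 ≤ l₀) (t : ℝ≥0) (k : Fin d) {H : ℝ≥0 → Ω → ℝ} (hH : IsStronglyPredictable 𝓕 H)
    {g : ℝ → ℝ} (hg : Measurable g) (hg0 : ∀ y, 0 ≤ y → 0 ≤ g y)
    (hgi : ∀ x, l₀ ≤ x → Integrable g (ν k x))
    (hi : Integrable (fun z => H z.2.toNNReal z.1 * (leftVersion l₀ lam z.2.toNNReal z.1 k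
          * ∫ y, g y ∂(ν k (leftVersion l₀ lam z.2.toNNReal z.1))))
        (P.prod (volume.restrict (Set.Ioc 0 (t : ℝ))))) :
    Integrable (fun ω => ∑' n, {ω | X n ω = k ∧ T n ω ≤ t}.indicator
        (fun ω => H (T n ω).toNNReal ω * g (Y n k ω)) ω) P ∧
    ∫ ω, ∑' n, {ω | X n ω = k ∧ T n ω ≤ t}.indicator
        (fun ω => H (T n ω).toNNReal ω * g (Y n k ω)) ω ∂P
      = ∫ z, H z.2.toNNReal z.1 * (leftVersion l₀ lam z.2.toNNReal z.1 k
          * ∫ y, g y ∂(ν k (leftVersion l₀ lam z.2.toNNReal z.1)))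
        ∂(P.prod (volume.restrict (Set.Ioc 0 (t : ℝ)))) := by
  -- Positive and negative parts of H are treated separately. The factor g needs no splitting, as it
  -- is nonnegative at every actual size.
  set Z : (ℝ≥0 → Ω → ℝ) → Ω → ℝ≥0∞ := fun K ω => ∑' n, {ω | X n ω = k ∧ T n ω ≤ t}.indicator
        (fun ω => ENNReal.ofReal (K (T n ω).toNNReal ω) * ENNReal.ofReal (g (Y n k ω))) ω with hZ
  have hev : ∀ n, MeasurableSet {ω | X n ω = k ∧ T n ω ≤ t} := fun n =>
    (measurableSet_eq_fun (h.measurable_type n) measurable_const).inter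
      (measurableSet_le (h.measurable_time n) measurable_const)
  have hZm : ∀ K, IsStronglyPredictable 𝓕 K → Measurable (Z K) := fun K hK =>
    Measurable.tsum fun n => Measurable.indicator
      ((h.measurable_at_time (measurable_of_isStronglyPredictable hK) n).ennreal_ofReal.mul
        (hg.comp (h.measurable_size n k)).ennreal_ofReal) (hev n)
  have hZi : ∀ K, IsStronglyPredictable 𝓕 K → ∫⁻ ω, Z K ω ∂P
      = ∫⁻ z, ENNReal.ofReal (K z.2.toNNReal z.1 * (leftVersion l₀ lam z.2.toNNReal z.1 k
          * ∫ y, g y ∂(ν k (leftVersion l₀ lam z.2.toNNReal z.1))))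
        ∂(P.prod (volume.restrict (Set.Ioc 0 (t : ℝ)))) := by
    intro K hK
    have hK' : IsStronglyPredictable 𝓕 fun s ω => ENNReal.ofReal (K s ω) := by
      let := 𝓕.predictable
      exact (StronglyMeasurable.measurable hK).ennreal_ofReal.stronglyMeasurable
    rw [h.lintegral_tsum_size_le t k hK' hg.ennreal_ofReal]
    have hae := h.ae_lintegral_size_eq hl₀ t k hg0 hgi
    refine lintegral_congr_ae ?_
    filter_upwards [hae] with z hz
    rw [mul_assoc, hz.2, ENNReal.ofReal_mul' hz.1]
  have hHn : IsStronglyPredictable 𝓕 fun s ω => -H s ω := by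
    let := 𝓕.predictable
    exact (StronglyMeasurable.measurable hH).neg.stronglyMeasurable
  have hp := hZi H hH
  have hm := hZi _ hHn
  simp only [neg_mul] at hm
  have hpf : ∫⁻ ω, Z H ω ∂P ≠ ∞ := by
    rw [hp]; exact hi.lintegral_lt_top.ne
  have hmf : ∫⁻ ω, Z (fun s ω => -H s ω) ω ∂P ≠ ∞ := by
    rw [hm]; exact hi.neg.lintegral_lt_top.ne
  have hpi := integrable_toReal_of_lintegral_ne_top (hZm H hH).aemeasurable hpf
  have hmi := integrable_toReal_of_lintegral_ne_top (hZm _ hHn).aemeasurable hmf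
  have heq : (fun ω => ∑' n, {ω | X n ω = k ∧ T n ω ≤ t}.indicator
        (fun ω => H (T n ω).toNNReal ω * g (Y n k ω)) ω)
      =ᵐ[P] fun ω => (Z H ω).toReal - (Z (fun s ω => -H s ω) ω).toReal := by
    filter_upwards [h.ae_summable_size t k fun n ω =>
        (ENNReal.ofReal (H (T n ω).toNNReal ω) * ENNReal.ofReal (g (Y n k ω))).toReal,
      h.ae_summable_size t k fun n ω =>
        (ENNReal.ofReal (-H (T n ω).toNNReal ω) * ENNReal.ofReal (g (Y n k ω))).toReal]
      with ω h1 h2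
    have htr : ∀ K : ℝ≥0 → Ω → ℝ, (Z K ω).toReal = ∑' n, {ω | X n ω = k ∧ T n ω ≤ t}.indicator
        (fun ω => (ENNReal.ofReal (K (T n ω).toNNReal ω)
          * ENNReal.ofReal (g (Y n k ω))).toReal) ω := by
      intro K
      simp only [hZ]
      rw [ENNReal.tsum_toReal_eq]
      · congr 1; funext n
        simp only [Set.indicator_apply]; split_ifs <;> simp
      · intro n
        simp only [Set.indicator_apply]
        split_ifs
        · exact ENNReal.mul_ne_top ENNReal.ofReal_ne_top ENNReal.ofReal_ne_top
        · simp
    rw [htr H, htr fun s ω => -H s ω, ← h1.tsum_sub h2]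
    congr 1; funext n
    simp only [Set.indicator_apply]
    split_ifs
    · simp only [ENNReal.toReal_mul, ENNReal.toReal_ofReal', max_eq_left (hg0 _ (h.size_nonneg n k ω))]
      rw [← sub_mul, max_zero_sub_max_neg_zero_eq_self]
    · simp
  refine ⟨(hpi.sub hmi).congr heq.symm, ?_⟩
  rw [integral_congr_ae heq, integral_sub hpi hmi,
    integral_toReal (hZm H hH).aemeasurable (ae_lt_top (hZm H hH) hpf),
    integral_toReal (hZm _ hHn).aemeasurable (ae_lt_top (hZm _ hHn) hmf), hp, hm,
    integral_eq_lintegral_pos_part_sub_lintegral_neg_part hi]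

end IsLinearModel

/-! ### The energy inequality in expectation -/

theorem exists_abs_dotProduct_mulVec_le {d : ℕ} (A : Matrix (Fin d) (Fin d) ℝ) (v : Fin d → ℝ) :
    ∃ C, 0 ≤ C ∧ ∀ x : Fin d → ℝ, |2 * (x ⬝ᵥ A.mulVec (x - v))| ≤ C * (1 + x ⬝ᵥ x) := by
  set S := ∑ i, ∑ j, |A i j| with hS
  have hS0 : 0 ≤ S := Finset.sum_nonneg fun i _ => Finset.sum_nonneg fun j _ => abs_nonneg _
  have hquad : ∀ x : Fin d → ℝ, |x ⬝ᵥ A.mulVec x| ≤ S * (x ⬝ᵥ x) := by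
    intro x
    simp only [dotProduct, Matrix.mulVec, Finset.mul_sum]
    refine (Finset.abs_sum_le_sum_abs _ _).trans ?_
    rw [hS, ← Finset.mul_sum, Finset.sum_mul]
    refine Finset.sum_le_sum fun i _ => ?_
    refine (Finset.abs_sum_le_sum_abs _ _).trans ?_
    rw [Finset.sum_mul]
    refine Finset.sum_le_sum fun j _ => ?_
    have h1 := abs_apply_le_sqrt x i
    have h2 := abs_apply_le_sqrt x j
    have h3 := mul_le_mul h1 h2 (abs_nonneg _) (Real.sqrt_nonneg _)
    rw [Real.mul_self_sqrt (dotProduct_self_nonneg x)] at h3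
    rw [abs_mul, abs_mul]
    calc |x i| * (|A i j| * |x j|) = |A i j| * (|x i| * |x j|) := by ring
      _ ≤ _ := mul_le_mul_of_nonneg_left h3 (abs_nonneg _)
  refine ⟨2 * S + 2 * √(A.mulVec v ⬝ᵥ A.mulVec v), by positivity, fun x => ?_⟩
  have h1 := hquad x
  have h2 := abs_dotProduct_le_sqrt x (A.mulVec v)
  have h3 : √(x ⬝ᵥ x) ≤ 1 + x ⬝ᵥ x := by
    have := Real.sq_sqrt (dotProduct_self_nonneg x)
    nlinarith [sq_nonneg (√(x ⬝ᵥ x) - 1), Real.sqrt_nonneg (x ⬝ᵥ x)]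
  have h4 := mul_le_mul_of_nonneg_right h3 (Real.sqrt_nonneg (A.mulVec v ⬝ᵥ A.mulVec v))
  rw [Matrix.mulVec_sub, dotProduct_sub, abs_mul, abs_two]
  have h5 := abs_sub (x ⬝ᵥ A.mulVec x) (x ⬝ᵥ A.mulVec v)
  nlinarith [h1, h2, h4, h5]

theorem measurable_integral_kernel {d : ℕ} (κ : Kernel (Fin d → ℝ) ℝ) {g : ℝ → ℝ}
    (hg : Measurable g) : Measurable fun x => ∫ y, g y ∂(κ x) :=
  hg.stronglyMeasurable.integral_kernel.measurable

namespace IsLinearModel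

variable {d : ℕ} {A B : Matrix (Fin d) (Fin d) ℝ} {l₀ l : Fin d → ℝ}
    {ν : Fin d → Kernel (Fin d → ℝ) ℝ}
    {Ω : Type*} [mΩ : MeasurableSpace Ω] {P : Measure Ω} {𝓕 : Filtration ℝ≥0 mΩ}
    {T : ℕ → Ω → ℝ≥0∞} {X : ℕ → Ω → Fin d} {Y : ℕ → Fin d → Ω → ℝ}
    {lam : ℝ≥0 → Ω → Fin d → ℝ}

/-- Left limits never leave the state space, so domination is needed only there and only for times
up to t. This reduces all integrability questions to the energy and its slope. -/
theorem integrable_of_bound (h : IsLinearModel A B l₀ ν l P 𝓕 T X Y lam) {t : ℝ≥0}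
    {F : ℝ≥0 → (Fin d → ℝ) → ℝ} (hF : Measurable (Function.uncurry F)) {G : (Fin d → ℝ) → ℝ}
    (hG : Integrable (fun z : Ω × ℝ => G (leftVersion l₀ lam z.2.toNNReal z.1))
      (P.prod (volume.restrict (Set.Ioc 0 (t : ℝ)))))
    (hFG : ∀ s ≤ t, ∀ x, l₀ ≤ x → |F s x| ≤ G x) :
    Integrable (fun z : Ω × ℝ => F z.2.toNNReal (leftVersion l₀ lam z.2.toNNReal z.1))
      (P.prod (volume.restrict (Set.Ioc 0 (t : ℝ)))) := by
  have hsw : Measurable fun z : Ω × ℝ => (z.2.toNNReal, z.1) := by fun_prop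
  have hΛ := (measurable_leftVersion l₀ h.adapted_intensity).comp hsw
  refine hG.mono' ?_ ?_
  · exact (hF.comp (hsw.fst.prodMk hΛ)).aestronglyMeasurable
  · have h1 : ∀ᵐ z ∂(P.prod (volume.restrict (Set.Ioc 0 (t : ℝ)))), z.2 ∈ Set.Ioc 0 (t : ℝ) :=
      Measure.quasiMeasurePreserving_snd.ae (ae_restrict_mem measurableSet_Ioc)
    filter_upwards [h1] with z hz
    exact hFG _ (Real.toNNReal_le_iff_le_coe.2 hz.2) _ (le_leftVersion _ _ _ _)

-- The pathwise inequality in the form the compensator formula accepts: left limits in the time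
-- integral, where they differ on a null set of times, and the event sum regrouped by type and by
-- power of the size.
open Classical in
theorem ae_energy_le (h : IsLinearModel A B l₀ ν l P 𝓕 T X Y lam) {Φ q : (Fin d → ℝ) → ℝ}
    (hΦ : IsConcaveEnergy Φ q) (β : ℝ) (t : ℝ≥0) :
    ∀ᵐ ω ∂P, Real.exp (β * t) * Φ (lam t ω) ≤ Φ l
      + (∫ s in Set.Ioc 0 (t : ℝ), Real.exp (β * s.toNNReal)
        * (β * Φ (leftVersion l₀ lam s.toNNReal ω) + q (leftVersion l₀ lam s.toNNReal ω)
          * (2 * (leftVersion l₀ lam s.toNNReal ω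
              ⬝ᵥ A.mulVec (leftVersion l₀ lam s.toNNReal ω - l₀)))))
      + ((∑ k, ∑' n, {ω | X n ω = k ∧ T n ω ≤ t}.indicator (fun ω =>
            Real.exp (β * (T n ω).toNNReal) * (q (leftVersion l₀ lam (T n ω).toNNReal ω)
              * (2 * (leftVersion l₀ lam (T n ω).toNNReal ω ⬝ᵥ B.col k))) * Y n k ω) ω)
        + ∑ k, ∑' n, {ω | X n ω = k ∧ T n ω ≤ t}.indicator (fun ω =>
            Real.exp (β * (T n ω).toNNReal) * (q (leftVersion l₀ lam (T n ω).toNNReal ω)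
              * (B.col k ⬝ᵥ B.col k)) * Y n k ω ^ 2) ω) := by
  filter_upwards [h.ae_isJumpPath, h.ae_tendsto_leftVersion, h.ae_eq_leftVersion] with ω hp hl he
  refine (hp.energy_le hΦ β t hl).trans (le_of_eq ?_)
  have hint : (∫ s in (0 : ℝ)..t, Real.exp (β * s) * (β * Φ (lam s.toNNReal ω)
        + q (lam s.toNNReal ω) * (2 * (lam s.toNNReal ω ⬝ᵥ A.mulVec (lam s.toNNReal ω - l₀)))))
      = ∫ s in Set.Ioc 0 (t : ℝ), Real.exp (β * s.toNNReal)
        * (β * Φ (leftVersion l₀ lam s.toNNReal ω) + q (leftVersion l₀ lam s.toNNReal ω)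
          * (2 * (leftVersion l₀ lam s.toNNReal ω
              ⬝ᵥ A.mulVec (leftVersion l₀ lam s.toNNReal ω - l₀)))) := by
    rw [intervalIntegral.integral_of_le t.coe_nonneg]
    refine integral_congr_ae ?_
    filter_upwards [ae_restrict_mem measurableSet_Ioc,
      ae_restrict_of_ae_restrict_of_subset Set.Ioc_subset_Ioi_self he] with s hs hse
    rw [hse, Real.coe_toNNReal s hs.1.le]
  rw [hint]
  congr 1
  have htsum : ∀ (k : Fin d) (a : ℕ → Ω → ℝ),
      ∑' n, {ω | X n ω = k ∧ T n ω ≤ t}.indicator (a n) ω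
        = ∑ n ∈ hp.events t, if X n ω = k then a n ω else 0 := by
    intro k a
    rw [tsum_eq_sum (s := hp.events t)]
    · refine Finset.sum_congr rfl fun n hn => ?_
      simp only [Set.indicator_apply, Set.mem_ofPred_eq, hp.mem_events.1 hn, and_true]
    · intro n hn
      exact Set.indicator_of_notMem (fun h2 => hn (hp.mem_events.2 h2.2)) _
  simp only [htsum]
  rw [Finset.sum_comm, Finset.sum_comm (s := Finset.univ), ← Finset.sum_add_distrib]
  refine Finset.sum_congr rfl fun n hn => ?_
  simp only [Finset.sum_ite_eq, Finset.mem_univ, if_true, ENNReal.toReal]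
  ring

/-- The energy estimate in expectation. -/
theorem integral_energy_le [IsProbabilityMeasure P] (h : IsLinearModel A B l₀ ν l P 𝓕 T X Y lam)
    (hl₀ : 0 ≤ l₀) (hA : LinearAssumption A B l₀ ν) {c : ℝ}
    (hc : ∀ x, l₀ ≤ x →
      2 * (x ⬝ᵥ A.mulVec (x - l₀)) + ∑ k, x k * (2 * (x ⬝ᵥ B.col k) * ∫ y, y ∂(ν k x)
          + (B.col k ⬝ᵥ B.col k) * ∫ y, y ^ 2 ∂(ν k x))
        ≤ supGamma A B l₀ ν * (x ⬝ᵥ x) + c * √(x ⬝ᵥ x))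
    {Φ q : (Fin d → ℝ) → ℝ} (hΦ : IsConcaveEnergy Φ q) {β K : ℝ}
    (hK : ∀ x, β * Φ x + q x * (supGamma A B l₀ ν * (x ⬝ᵥ x) + c * √(x ⬝ᵥ x)) ≤ K) (t : ℝ≥0)
    (hi1 : Integrable (fun z : Ω × ℝ => Φ (leftVersion l₀ lam z.2.toNNReal z.1))
      (P.prod (volume.restrict (Set.Ioc 0 (t : ℝ)))))
    (hi2 : Integrable (fun z : Ω × ℝ => q (leftVersion l₀ lam z.2.toNNReal z.1)
        * (1 + leftVersion l₀ lam z.2.toNNReal z.1 ⬝ᵥ leftVersion l₀ lam z.2.toNNReal z.1))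
      (P.prod (volume.restrict (Set.Ioc 0 (t : ℝ))))) :
    Integrable (fun ω => Φ (lam t ω)) P ∧
    Real.exp (β * t) * ∫ ω, Φ (lam t ω) ∂P
      ≤ Φ l + K * ∫ s in Set.Ioc 0 (t : ℝ), Real.exp (β * s) := by
  have hΦm : Measurable Φ := hΦ.continuous_energy.measurable
  have hqm : Measurable q := hΦ.continuous_slope.measurable
  have hexp : ∀ s ≤ t, Real.exp (β * s) ≤ Real.exp (|β| * t) := by
    intro s hs
    refine Real.exp_le_exp.2 ?_
    exact (mul_le_mul_of_nonneg_right (le_abs_self β) s.coe_nonneg).trans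
      (mul_le_mul_of_nonneg_left (by exact_mod_cast hs) (abs_nonneg β))
  have hsqrt : ∀ x : Fin d → ℝ, √(x ⬝ᵥ x) ≤ 1 + x ⬝ᵥ x := fun x => by
    have := Real.sq_sqrt (dotProduct_self_nonneg x)
    nlinarith [sq_nonneg (√(x ⬝ᵥ x) - 1), Real.sqrt_nonneg (x ⬝ᵥ x)]
  obtain ⟨CA, hCA0, hCA⟩ := exists_abs_dotProduct_mulVec_le A l₀
  obtain ⟨K₁, hK₁⟩ := hA.bounded_first
  obtain ⟨K₂, hK₂⟩ := hA.bounded_second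
  -- the drift
  have hD := h.integrable_of_bound (t := t)
    (F := fun s x => Real.exp (β * s) * (β * Φ x + q x * (2 * (x ⬝ᵥ A.mulVec (x - l₀)))))
    (G := fun x => Real.exp (|β| * t) * (|β| * Φ x + CA * (q x * (1 + x ⬝ᵥ x)))) (by
      have h1 : Measurable fun x => 2 * (x ⬝ᵥ A.mulVec (x - l₀)) :=
        Continuous.measurable (by fun_prop)
      simp only [Function.uncurry_def]
      fun_prop) (((hi1.const_mul _).add (hi2.const_mul _)).const_mul _) (by
      intro s hs x _
      rw [abs_mul, abs_of_pos (Real.exp_pos _)]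
      refine mul_le_mul (hexp s hs) ?_ (abs_nonneg _) (Real.exp_pos _).le
      refine (abs_add_le _ _).trans (add_le_add ?_ ?_)
      · rw [abs_mul, abs_of_nonneg (hΦ.energy_nonneg x)]
      · rw [abs_mul, abs_of_nonneg (hΦ.slope_nonneg x)]
        refine (mul_le_mul_of_nonneg_left (hCA x) (hΦ.slope_nonneg x)).trans (le_of_eq (by ring)))
  -- the part of the jumps that is linear in the size
  have hJ1 := fun k => h.integrable_of_bound (t := t)
    (F := fun s x => Real.exp (β * s) * (q x * (2 * (x ⬝ᵥ B.col k))) * (x k * ∫ y, y ∂(ν k x)))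
    (G := fun x => Real.exp (|β| * t) * (2 * √(B.col k ⬝ᵥ B.col k) * |K₁|)
      * (q x * (1 + x ⬝ᵥ x))) (by
      have h1 : Measurable fun x : Fin d → ℝ => 2 * (x ⬝ᵥ B.col k) :=
        Continuous.measurable (by fun_prop)
      have h2 := measurable_integral_kernel (ν k) measurable_id
      exact ((Real.measurable_exp.comp (measurable_fst.coe_nnreal_real.const_mul β)).mul
        ((hqm.comp measurable_snd).mul (h1.comp measurable_snd))).mul
        (((measurable_pi_apply k).comp measurable_snd).mul (h2.comp measurable_snd))) (hi2.const_mul _) (by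
      intro s hs x hx
      have h1 : |x ⬝ᵥ B.col k| * |x k| ≤ √(B.col k ⬝ᵥ B.col k) * (1 + x ⬝ᵥ x) := by
        have h2 := mul_le_mul (abs_dotProduct_le_sqrt x (B.col k)) (abs_apply_le_sqrt x k)
          (abs_nonneg _) (by positivity)
        have h3 := Real.mul_self_sqrt (dotProduct_self_nonneg x)
        nlinarith [Real.sqrt_nonneg (B.col k ⬝ᵥ B.col k)]
      have h4 := (hK₁ k x hx).trans (le_abs_self K₁)
      have h5 := hexp s hs
      have h6 := hΦ.slope_nonneg x
      simp only [abs_mul, abs_of_pos (Real.exp_pos _), abs_of_nonneg h6, abs_two]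
      calc Real.exp (β * s) * (q x * (2 * |x ⬝ᵥ B.col k|)) * (|x k| * |∫ y, y ∂(ν k x)|)
          = Real.exp (β * s) * (q x * (2 * (|x ⬝ᵥ B.col k| * |x k|))) * |∫ y, y ∂(ν k x)| := by
            ring
        _ ≤ Real.exp (|β| * t) * (q x * (2 * (√(B.col k ⬝ᵥ B.col k) * (1 + x ⬝ᵥ x))))
            * |K₁| := by
            have := dotProduct_self_nonneg x
            gcongr
        _ = _ := by ring)
  -- the part of the jumps that is quadratic in the size
  have hJ2 := fun k => h.integrable_of_bound (t := t)
    (F := fun s x => Real.exp (β * s) * (q x * (B.col k ⬝ᵥ B.col k)) * (x k * ∫ y, y ^ 2 ∂(ν k x)))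
    (G := fun x => Real.exp (|β| * t) * ((B.col k ⬝ᵥ B.col k) * |K₂|)
      * (q x * (1 + x ⬝ᵥ x))) (by
      have h2 := measurable_integral_kernel (ν k) (g := fun y => y ^ 2) (by fun_prop)
      exact ((Real.measurable_exp.comp (measurable_fst.coe_nnreal_real.const_mul β)).mul
        ((hqm.comp measurable_snd).mul_const _)).mul
        (((measurable_pi_apply k).comp measurable_snd).mul (h2.comp measurable_snd)))
      (hi2.const_mul _) (by
      intro s hs x hx
      have h1 : |x k| ≤ 1 + x ⬝ᵥ x := (abs_apply_le_sqrt x k).trans (hsqrt x)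
      have h4 : |∫ y, y ^ 2 ∂(ν k x)| ≤ |K₂| := by
        rw [abs_of_nonneg (integral_nonneg fun y => sq_nonneg y)]
        exact (hK₂ k x hx).trans (le_abs_self K₂)
      have h5 := hexp s hs
      have h6 := hΦ.slope_nonneg x
      have h7 := dotProduct_self_nonneg (B.col k)
      simp only [abs_mul, abs_of_pos (Real.exp_pos _), abs_of_nonneg h6, abs_of_nonneg h7]
      calc Real.exp (β * s) * (q x * (B.col k ⬝ᵥ B.col k)) * (|x k| * |∫ y, y ^ 2 ∂(ν k x)|)
          ≤ Real.exp (|β| * t) * (q x * (B.col k ⬝ᵥ B.col k)) * ((1 + x ⬝ᵥ x) * |K₂|) := by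
            have := dotProduct_self_nonneg x
            gcongr
        _ = _ := by ring)
  have hcomp1 := fun k => h.integral_tsum_size hl₀ t k
    (H := fun s ω => Real.exp (β * s) * (q (leftVersion l₀ lam s ω)
              * (2 * (leftVersion l₀ lam s ω ⬝ᵥ B.col k))))
    (isStronglyPredictable_comp l₀ h.adapted_intensity
      (G := fun s x => Real.exp (β * s) * (q x * (2 * (x ⬝ᵥ B.col k)))) (by
        have h1 : Measurable fun x : Fin d → ℝ => 2 * (x ⬝ᵥ B.col k) :=
          Continuous.measurable (by fun_prop)
        simp only [Function.uncurry_def]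
        fun_prop)) (g := fun y => y) measurable_id (fun y hy => hy)
      (fun x hx => hA.integrable_first k x hx) (hJ1 k)
  have hcomp2 := fun k => h.integral_tsum_size hl₀ t k
    (H := fun s ω => Real.exp (β * s) * (q (leftVersion l₀ lam s ω) * (B.col k ⬝ᵥ B.col k)))
    (isStronglyPredictable_comp l₀ h.adapted_intensity
      (G := fun s x => Real.exp (β * s) * (q x * (B.col k ⬝ᵥ B.col k))) (by
        simp only [Function.uncurry_def]
        fun_prop)) (g := fun y => y ^ 2) (by fun_prop) (fun y _ => sq_nonneg y)
      (fun x hx => hA.integrable_second k x hx) (hJ2 k)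
  have hae := h.ae_energy_le hΦ β t
  have hR1 := integrable_finsetSum Finset.univ fun k _ => (hcomp1 k).1
  have hR2 := integrable_finsetSum Finset.univ fun k _ => (hcomp2 k).1
  have hR0 := hD.integral_prod_left
  have hR := ((integrable_const (μ := P) (Φ l)).add hR0).add (hR1.add hR2)
  have hL : Integrable (fun ω => Real.exp (β * t) * Φ (lam t ω)) P := by
    refine hR.mono' ((hΦm.comp (h.measurable_intensity t)).const_mul _).aestronglyMeasurable ?_
    filter_upwards [hae] with ω hω
    rw [Real.norm_of_nonneg (mul_nonneg (Real.exp_pos _).le (hΦ.energy_nonneg _))]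
    exact hω
  have hI : Integrable (fun ω => Φ (lam t ω)) P := by
    have := hL.const_mul (Real.exp (β * t))⁻¹
    simpa only [inv_mul_cancel_left₀ (Real.exp_pos (β * t)).ne'] using this
  refine ⟨hI, ?_⟩
  -- In expectation each jump sum becomes its compensator. Together with the drift this reconstructs
  -- q times the generator of the squared norm under one integral over Ω × (0, t].
  have hle := integral_mono_ae hL hR hae
  rw [integral_const_mul, integral_add' ((integrable_const _).add hR0) (hR1.add hR2),
    integral_add' (integrable_const _) hR0, integral_add' hR1 hR2,
    integral_finsetSum _ fun k _ => (hcomp1 k).1, integral_finsetSum _ fun k _ => (hcomp2 k).1,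
    ← integral_prod _ hD, integral_const, probReal_univ, one_smul] at hle
  simp only [fun k => (hcomp1 k).2, fun k => (hcomp2 k).2] at hle
  rw [← integral_finsetSum _ fun k _ => hJ1 k, ← integral_finsetSum _ fun k _ => hJ2 k,
    ← integral_add' (integrable_finsetSum _ fun k _ => hJ1 k)
      (integrable_finsetSum _ fun k _ => hJ2 k), add_assoc,
    ← integral_add' hD ((integrable_finsetSum _ fun k _ => hJ1 k).add
      (integrable_finsetSum _ fun k _ => hJ2 k))] at hle
  refine hle.trans (add_le_add_right ?_ _)
  have hE : Integrable (fun z : Ω × ℝ => K * Real.exp (β * z.2))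
      (P.prod (volume.restrict (Set.Ioc 0 (t : ℝ)))) := by
    have h1 : IntegrableOn (fun s : ℝ => K * Real.exp (β * s)) (Set.Ioc 0 (t : ℝ)) :=
      (Continuous.integrableOn_Icc (by fun_prop)).mono_set Set.Ioc_subset_Icc_self
    exact h1.comp_snd P
  have hEeq : ∫ z : Ω × ℝ, K * Real.exp (β * z.2) ∂(P.prod (volume.restrict (Set.Ioc 0 (t : ℝ))))
      = K * ∫ s in Set.Ioc 0 (t : ℝ), Real.exp (β * s) := by
    rw [integral_fun_snd (fun s => K * Real.exp (β * s)), probReal_univ, one_smul,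
      integral_const_mul]
  rw [← hEeq]
  refine integral_mono_ae (hD.add ((integrable_finsetSum _ fun k _ => hJ1 k).add
      (integrable_finsetSum _ fun k _ => hJ2 k))) hE ?_
  have hmem : ∀ᵐ z ∂(P.prod (volume.restrict (Set.Ioc 0 (t : ℝ)))), z.2 ∈ Set.Ioc 0 (t : ℝ) :=
    Measure.quasiMeasurePreserving_snd.ae (ae_restrict_mem measurableSet_Ioc)
  filter_upwards [hmem] with z hz
  have hx := le_leftVersion l₀ lam z.2.toNNReal z.1
  simp only [Pi.add_apply]
  set x := leftVersion l₀ lam z.2.toNNReal z.1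
  rw [Real.coe_toNNReal z.2 hz.1.le]
  -- Nonnegativity of the slope lets it multiply the generator bound; `hK` then removes the
  -- dependence on the state.
  have h1 := mul_le_mul_of_nonneg_left (hc x hx) (hΦ.slope_nonneg x)
  have h2 := (add_le_add_right h1 (β * Φ x)).trans (hK x)
  have h3 := mul_le_mul_of_nonneg_left h2 (Real.exp_pos (β * z.2)).le
  rw [mul_comm K]
  refine le_trans (le_of_eq ?_) h3
  rw [← Finset.sum_add_distrib, mul_add (q x), ← add_assoc, 
    mul_add (Real.exp (β * z.2)) (β * Φ x + q x * (2 * (x ⬝ᵥ A.mulVec (x - l₀)))),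
    Finset.mul_sum, Finset.mul_sum]
  congr 1
  exact Finset.sum_congr rfl fun k _ => by ring

end IsLinearModel

/-! ### Two concave energies -/

theorem hasDerivWithinAt_dotProduct_self {d : ℕ} {u : ℝ → Fin d → ℝ} {u' : Fin d → ℝ} {S : Set ℝ}
    {s : ℝ} (hu : HasDerivWithinAt u u' S s) :
    HasDerivWithinAt (fun r => u r ⬝ᵥ u r) (2 * (u s ⬝ᵥ u')) S s := by
  have h1 : ∀ i, HasDerivWithinAt (fun r => u r i) (u' i) S s := hasDerivWithinAt_pi.1 hu
  have h2 := HasDerivWithinAt.fun_sum (u := Finset.univ) fun i _ => (h1 i).mul (h1 i)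
  refine h2.congr_deriv ?_
  simp only [dotProduct, Finset.mul_sum]
  exact Finset.sum_congr rfl fun i _ => by ring

/-- A bounded concave function of `x ⬝ᵥ x`. -/
theorem isConcaveEnergy_div {d : ℕ} {ε : ℝ} (hε : 0 < ε) :
    IsConcaveEnergy (d := d) (fun x => (x ⬝ᵥ x) / (1 + ε * (x ⬝ᵥ x)))
      (fun x => 1 / (1 + ε * (x ⬝ᵥ x)) ^ 2) := by
  have hpos : ∀ x : Fin d → ℝ, 0 < 1 + ε * (x ⬝ᵥ x) := fun x => by
    have := dotProduct_self_nonneg x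
    positivity
  have hne : ∀ x : Fin d → ℝ, 1 + ε * (x ⬝ᵥ x) ≠ 0 := fun x => (hpos x).ne'
  refine ⟨?_, ?_, ?_, ?_, ?_, ?_⟩
  · exact Continuous.div (by fun_prop) (by fun_prop) hne
  · exact Continuous.div (by fun_prop) (by fun_prop) fun x => pow_ne_zero 2 (hne x)
  · exact fun x => div_nonneg (dotProduct_self_nonneg x) (hpos x).le
  · exact fun x => by positivity
  · intro x y
    have hx := hpos x
    have hy := hpos y
    generalize x ⬝ᵥ x = a at *
    generalize y ⬝ᵥ y = b at *
    -- The gap between the tangent and the function is an explicit nonnegative square, which proves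
    -- concavity.
    have : a / (1 + ε * a) + 1 / (1 + ε * a) ^ 2 * (b - a) - b / (1 + ε * b)
        = ε * (b - a) ^ 2 / ((1 + ε * a) ^ 2 * (1 + ε * b)) := by
      obtain ⟨u, hu⟩ : ∃ u, u = 1 + ε * a := ⟨_, rfl⟩
      obtain ⟨v, hv⟩ : ∃ v, v = 1 + ε * b := ⟨_, rfl⟩
      rw [← hu] at hx ⊢
      rw [← hv] at hy ⊢
      field_simp
      rw [hu, hv]
      ring
    have h2 : 0 ≤ ε * (b - a) ^ 2 / ((1 + ε * a) ^ 2 * (1 + ε * b)) := by positivity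
    linarith
  · intro u u' s hu
    have h1 := hasDerivWithinAt_dotProduct_self hu
    have h2 := h1.div ((h1.const_mul ε).const_add 1) (hne (u s))
    refine h2.congr_deriv ?_
    have := hne (u s)
    field_simp
    ring

/-- A regularisation of the Euclidean norm. -/
theorem isConcaveEnergy_sqrt {d : ℕ} {δ : ℝ} (hδ : 0 < δ) :
    IsConcaveEnergy (d := d) (fun x => √(x ⬝ᵥ x + δ)) (fun x => 1 / (2 * √(x ⬝ᵥ x + δ))) := by
  have hpos : ∀ x : Fin d → ℝ, 0 < √(x ⬝ᵥ x + δ) := fun x => by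
    have := dotProduct_self_nonneg x
    positivity
  have hne : ∀ x : Fin d → ℝ, 2 * √(x ⬝ᵥ x + δ) ≠ 0 := fun x => (mul_pos two_pos (hpos x)).ne'
  refine ⟨by fun_prop, ?_, fun x => (hpos x).le, ?_, ?_, ?_⟩
  · exact Continuous.div (by fun_prop) (by fun_prop) hne
  · exact fun x => by positivity
  · intro x y
    have hx := hpos x
    have h1 : y ⬝ᵥ y - x ⬝ᵥ x = √(y ⬝ᵥ y + δ) ^ 2 - √(x ⬝ᵥ x + δ) ^ 2 := by
      rw [Real.sq_sqrt (add_nonneg (dotProduct_self_nonneg y) hδ.le),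
        Real.sq_sqrt (add_nonneg (dotProduct_self_nonneg x) hδ.le)]
      ring
    rw [h1]
    generalize √(x ⬝ᵥ x + δ) = a at *
    generalize √(y ⬝ᵥ y + δ) = b at *
    have : a + 1 / (2 * a) * (b ^ 2 - a ^ 2) - b = (b - a) ^ 2 / (2 * a) := by
      field_simp
      ring
    have h2 : 0 ≤ (b - a) ^ 2 / (2 * a) := by positivity
    linarith
  · intro u u' s hu
    have h1 := (hasDerivWithinAt_dotProduct_self hu).add_const δ
    refine (h1.sqrt (Real.sqrt_pos.1 (hpos (u s))).ne').congr_deriv ?_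
    ring

/-! ### Moment bounds for the intensity -/

namespace IsLinearModel

variable {d : ℕ} {A B : Matrix (Fin d) (Fin d) ℝ} {l₀ l : Fin d → ℝ}
    {ν : Fin d → Kernel (Fin d → ℝ) ℝ}
    {Ω : Type*} [mΩ : MeasurableSpace Ω] {P : Measure Ω} {𝓕 : Filtration ℝ≥0 mΩ}
    {T : ℕ → Ω → ℝ≥0∞} {X : ℕ → Ω → Fin d} {Y : ℕ → Fin d → Ω → ℝ}
    {lam : ℝ≥0 → Ω → Fin d → ℝ}

/-- The second moment of the intensity grows at most linearly. -/
theorem lintegral_dotProduct_self_le [IsProbabilityMeasure P]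
    (h : IsLinearModel A B l₀ ν l P 𝓕 T X Y lam)
    (hl₀ : 0 ≤ l₀) (hA : LinearAssumption A B l₀ ν) {c : ℝ}
    (hc : ∀ x, l₀ ≤ x →
      2 * (x ⬝ᵥ A.mulVec (x - l₀)) + ∑ k, x k * (2 * (x ⬝ᵥ B.col k) * ∫ y, y ∂(ν k x)
          + (B.col k ⬝ᵥ B.col k) * ∫ y, y ^ 2 ∂(ν k x))
        ≤ supGamma A B l₀ ν * (x ⬝ᵥ x) + c * √(x ⬝ᵥ x)) (t : ℝ≥0) :
    ∫⁻ ω, ENNReal.ofReal (lam t ω ⬝ᵥ lam t ω) ∂P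
      ≤ ENNReal.ofReal (l ⬝ᵥ l + c ^ 2 / (4 * -supGamma A B l₀ ν) * t) := by
  set γ := supGamma A B l₀ ν with hγ
  have hγ0 : 0 < -γ := neg_pos.2 hA.sup_neg
  -- The maximum over real r of γr² + cr, found by completing the square.
  set K := c ^ 2 / (4 * -γ) with hK
  have hK0 : 0 ≤ K := by positivity
  have hgen : ∀ x : Fin d → ℝ, γ * (x ⬝ᵥ x) + c * √(x ⬝ᵥ x) ≤ K := by
    intro x
    rw [hK, le_div_iff₀ (by positivity)]
    have h1 := Real.sq_sqrt (dotProduct_self_nonneg x)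
    generalize √(x ⬝ᵥ x) = r at *
    rw [← h1]
    linarith [sq_nonneg (2 * γ * r + c)]
  -- This energy is bounded, and its slope decays fast enough for both integrability conditions to
  -- hold trivially. The slope is at most 1, so with β = 0 the growth rate K is uniform in ε.
  have key : ∀ ε : ℝ, 0 < ε →
      ∫⁻ ω, ENNReal.ofReal ((lam t ω ⬝ᵥ lam t ω) / (1 + ε * (lam t ω ⬝ᵥ lam t ω))) ∂P
        ≤ ENNReal.ofReal (l ⬝ᵥ l + K * t) := by
    intro ε hε
    have hconst : ∀ r : ℝ, Integrable (fun _ : Ω × ℝ => r)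
        (P.prod (volume.restrict (Set.Ioc 0 (t : ℝ)))) := fun r => integrable_const r
    have hE := isConcaveEnergy_div (d := d) hε
    have hb1 : ∀ x : Fin d → ℝ, (x ⬝ᵥ x) / (1 + ε * (x ⬝ᵥ x)) ≤ 1 / ε := fun x => by
      have := dotProduct_self_nonneg x
      rw [div_le_div_iff₀ (by positivity) hε]
      linarith
    have hb0 : ∀ x : Fin d → ℝ, 1 / (1 + ε * (x ⬝ᵥ x)) ^ 2 ≤ 1 / (1 + ε * (x ⬝ᵥ x)) := fun x => by
      have := dotProduct_self_nonneg x
      have h2 : 0 ≤ ε * (x ⬝ᵥ x) := by positivity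
      exact one_div_le_one_div_of_le (by positivity) (by nlinarith)
    have hb0' : ∀ x : Fin d → ℝ, 1 / (1 + ε * (x ⬝ᵥ x)) ≤ 1 := fun x => by
      have := dotProduct_self_nonneg x
      rw [div_le_one (by positivity)]
      have h2 : 0 ≤ ε * (x ⬝ᵥ x) := by positivity
      linarith
    have h1 := h.integral_energy_le hl₀ hA hc hE (β := 0) (K := K) (by
        intro x
        rw [zero_mul, zero_add]
        have h2 := mul_le_mul_of_nonneg_left (hgen x) (hE.slope_nonneg x)
        have h3 := mul_le_mul_of_nonneg_right ((hb0 x).trans (hb0' x)) hK0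
        rw [one_mul] at h3
        exact h2.trans h3) t
      (h.integrable_of_bound (F := fun _ x => (x ⬝ᵥ x) / (1 + ε * (x ⬝ᵥ x))) (G := fun _ => 1 / ε)
        (hE.continuous_energy.measurable.comp measurable_snd) (hconst _) (by
          intro s _ x _
          rw [abs_of_nonneg (hE.energy_nonneg x)]
          exact hb1 x))
      (h.integrable_of_bound (F := fun _ x => 1 / (1 + ε * (x ⬝ᵥ x)) ^ 2 * (1 + x ⬝ᵥ x))
        (G := fun _ => 1 + 1 / ε) (by
          have h2 := hE.continuous_slope.measurable.comp
            (measurable_snd : Measurable (Prod.snd : ℝ≥0 × (Fin d → ℝ) → _))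
          exact h2.mul (Continuous.measurable (by fun_prop))) (hconst _) (by
          intro s _ x _
          have h3 := dotProduct_self_nonneg x
          have h4 : 0 ≤ 1 + x ⬝ᵥ x := by linarith
          rw [abs_of_nonneg (mul_nonneg (hE.slope_nonneg x) h4)]
          refine (mul_le_mul_of_nonneg_right (hb0 x) h4).trans ?_
          have h5 := hb0' x
          have h6 := hb1 x
          rw [mul_add, mul_one, one_div_mul_eq_div]
          exact add_le_add h5 h6))
    have h2 := h1.2
    simp only [zero_mul, Real.exp_zero, one_mul, integral_const, MeasurableSet.univ,
      measureReal_restrict_apply, Set.univ_inter, Real.volume_real_Ioc_of_le t.coe_nonneg,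
      sub_zero, smul_eq_mul, mul_one] at h2
    rw [← ofReal_integral_eq_lintegral_ofReal h1.1
      (Eventually.of_forall fun ω => hE.energy_nonneg _)]
    refine ENNReal.ofReal_le_ofReal (h2.trans (add_le_add_left ?_ _))
    have h3 := dotProduct_self_nonneg l
    exact div_le_self h3 (by have : 0 ≤ ε * (l ⬝ᵥ l) := by positivity
                             linarith)
  have hlim : ∀ ω, Tendsto (fun n : ℕ => ENNReal.ofReal ((lam t ω ⬝ᵥ lam t ω)
      / (1 + 1 / ((n : ℝ) + 1) * (lam t ω ⬝ᵥ lam t ω)))) atTop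
      (𝓝 (ENNReal.ofReal (lam t ω ⬝ᵥ lam t ω))) := by
    intro ω
    refine (ENNReal.continuous_ofReal.tendsto _).comp ?_
    have h1 := ((tendsto_one_div_add_atTop_nhds_zero_nat (𝕜 := ℝ)).mul_const
      (lam t ω ⬝ᵥ lam t ω)).const_add 1
    have h2 : Tendsto (fun n : ℕ => (lam t ω ⬝ᵥ lam t ω)
        / (1 + 1 / ((n : ℝ) + 1) * (lam t ω ⬝ᵥ lam t ω))) atTop
        (𝓝 ((lam t ω ⬝ᵥ lam t ω) / (1 + 0 * (lam t ω ⬝ᵥ lam t ω)))) :=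
      (tendsto_const_nhds (x := lam t ω ⬝ᵥ lam t ω)).div h1 (by simp)
    simpa using h2
  -- Fatou along ε = 1/(n+1) removes the truncation.
  calc ∫⁻ ω, ENNReal.ofReal (lam t ω ⬝ᵥ lam t ω) ∂P
      = ∫⁻ ω, liminf (fun n : ℕ => ENNReal.ofReal ((lam t ω ⬝ᵥ lam t ω)
      / (1 + 1 / ((n : ℝ) + 1) * (lam t ω ⬝ᵥ lam t ω)))) atTop ∂P := by
        simp only [fun ω => (hlim ω).liminf_eq]
    _ ≤ liminf (fun n : ℕ => ∫⁻ ω, ENNReal.ofReal ((lam t ω ⬝ᵥ lam t ω)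
      / (1 + 1 / ((n : ℝ) + 1) * (lam t ω ⬝ᵥ lam t ω))) ∂P) atTop := by
        refine lintegral_liminf_le fun n => ?_
        exact ((isConcaveEnergy_div (d := d) (ε := 1 / ((n : ℝ) + 1))
          (by positivity)).continuous_energy.measurable.comp
            (h.measurable_intensity t)).ennreal_ofReal
    _ ≤ _ := liminf_le_of_le (by isBoundedDefault) fun b hb => by
        obtain ⟨n, hn⟩ := hb.exists
        exact hn.trans (key _ (by positivity))

/-- The second moment of the left limits is integrable over bounded time intervals. -/
theorem integrable_leftVersion [IsProbabilityMeasure P]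
    (h : IsLinearModel A B l₀ ν l P 𝓕 T X Y lam)
    (hl₀ : 0 ≤ l₀) (hA : LinearAssumption A B l₀ ν) {c : ℝ}
    (hc : ∀ x, l₀ ≤ x →
      2 * (x ⬝ᵥ A.mulVec (x - l₀)) + ∑ k, x k * (2 * (x ⬝ᵥ B.col k) * ∫ y, y ∂(ν k x)
          + (B.col k ⬝ᵥ B.col k) * ∫ y, y ^ 2 ∂(ν k x))
        ≤ supGamma A B l₀ ν * (x ⬝ᵥ x) + c * √(x ⬝ᵥ x)) (t : ℝ≥0) :
    Integrable (fun z : Ω × ℝ => leftVersion l₀ lam z.2.toNNReal z.1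
        ⬝ᵥ leftVersion l₀ lam z.2.toNNReal z.1)
      (P.prod (volume.restrict (Set.Ioc 0 (t : ℝ)))) := by
  have hsw : Measurable fun z : Ω × ℝ => (z.2.toNNReal, z.1) := by fun_prop
  have hΛ := (measurable_leftVersion l₀ h.adapted_intensity).comp hsw
  have hf : Measurable fun x : Fin d → ℝ => x ⬝ᵥ x := Continuous.measurable (by fun_prop)
  have hγ0 : 0 < -supGamma A B l₀ ν := neg_pos.2 hA.sup_neg
  set R := ENNReal.ofReal (l ⬝ᵥ l + c ^ 2 / (4 * -supGamma A B l₀ ν) * t) with hR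
  have hlam : ∀ s ≤ t, ∫⁻ ω, ENNReal.ofReal (lam s ω ⬝ᵥ lam s ω) ∂P ≤ R := fun s hs =>
    (h.lintegral_dotProduct_self_le hl₀ hA hc s).trans (ENNReal.ofReal_le_ofReal (by gcongr))
  have hleft : ∀ s, 0 < s → s ≤ t →
      ∫⁻ ω, ENNReal.ofReal (leftVersion l₀ lam s ω ⬝ᵥ leftVersion l₀ lam s ω) ∂P ≤ R := by
    intro s hs hst
    -- Fatou along the grid points below s, where the second moment is already bounded by R.
    calc ∫⁻ ω, ENNReal.ofReal (leftVersion l₀ lam s ω ⬝ᵥ leftVersion l₀ lam s ω) ∂P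
        = ∫⁻ ω, liminf (fun n => ENNReal.ofReal (lam (gridLeft n s) ω ⬝ᵥ lam (gridLeft n s) ω))
            atTop ∂P := by
          refine lintegral_congr_ae ?_
          filter_upwards [h.ae_tendsto_leftVersion] with ω hω
          have h1 : Continuous fun x : Fin d → ℝ => ENNReal.ofReal (x ⬝ᵥ x) :=
            ENNReal.continuous_ofReal.comp (by fun_prop)
          exact ((h1.tendsto _).comp ((hω s hs).comp (tendsto_gridLeft hs))).liminf_eq.symm
      _ ≤ liminf (fun n => ∫⁻ ω, ENNReal.ofReal
            (lam (gridLeft n s) ω ⬝ᵥ lam (gridLeft n s) ω) ∂P) atTop :=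
          lintegral_liminf_le fun n => (hf.comp (h.measurable_intensity _)).ennreal_ofReal
      _ ≤ R := liminf_le_of_le (by isBoundedDefault) fun b hb => by
          obtain ⟨n, hn⟩ := hb.exists
          exact hn.trans (hlam _ ((gridLeft_lt n hs).le.trans hst))
  have hfΛ : Measurable fun z : Ω × ℝ => leftVersion l₀ lam z.2.toNNReal z.1
      ⬝ᵥ leftVersion l₀ lam z.2.toNNReal z.1 := hf.comp hΛ
  refine ⟨hfΛ.aestronglyMeasurable, ?_⟩
  rw [hasFiniteIntegral_iff_ofReal (Eventually.of_forall fun z => dotProduct_self_nonneg _),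
    lintegral_prod_symm _ hfΛ.ennreal_ofReal.aemeasurable]
  calc ∫⁻ s in Set.Ioc 0 (t : ℝ), ∫⁻ ω, ENNReal.ofReal (leftVersion l₀ lam s.toNNReal ω
        ⬝ᵥ leftVersion l₀ lam s.toNNReal ω) ∂P
      ≤ ∫⁻ _ in Set.Ioc 0 (t : ℝ), R := by
        refine setLIntegral_mono measurable_const fun s hs => ?_
        exact hleft _ (Real.toNNReal_pos.2 hs.1) (Real.toNNReal_le_iff_le_coe.2 hs.2)
    _ < ∞ := by
        rw [setLIntegral_const]
        exact ENNReal.mul_lt_top ENNReal.ofReal_lt_top measure_Ioc_lt_top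

/-- The bound for the expected Euclidean norm of the intensity. -/
theorem integral_sqrt_le [IsProbabilityMeasure P]
    (h : IsLinearModel A B l₀ ν l P 𝓕 T X Y lam)
    (hl₀ : 0 ≤ l₀) (hA : LinearAssumption A B l₀ ν) {c : ℝ} (hc0 : 0 ≤ c)
    (hc : ∀ x, l₀ ≤ x →
      2 * (x ⬝ᵥ A.mulVec (x - l₀)) + ∑ k, x k * (2 * (x ⬝ᵥ B.col k) * ∫ y, y ∂(ν k x)
          + (B.col k ⬝ᵥ B.col k) * ∫ y, y ^ 2 ∂(ν k x))
        ≤ supGamma A B l₀ ν * (x ⬝ᵥ x) + c * √(x ⬝ᵥ x)) (t : ℝ≥0) {C₁ : ℝ}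
    (hC₁ : C₁ = -supGamma A B l₀ ν) :
    Integrable (fun ω => √(lam t ω ⬝ᵥ lam t ω)) P ∧
    ∫ ω, √(lam t ω ⬝ᵥ lam t ω) ∂P ≤ √(l ⬝ᵥ l) * Real.exp (-(C₁ / 2 * t))
      + c / C₁ * (1 - Real.exp (-(C₁ / 2 * t))) := by
  have hγ : supGamma A B l₀ ν = -C₁ := by rw [hC₁, neg_neg]
  have hC0 : 0 < C₁ := by rw [hC₁]; exact neg_pos.2 hA.sup_neg
  have hf2 := h.integrable_leftVersion hl₀ hA hc t
  have hone : Integrable (fun _ : Ω × ℝ => (1 : ℝ))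
    (P.prod (volume.restrict (Set.Ioc 0 (t : ℝ)))) := integrable_const 1
  set I := ∫ s in Set.Ioc 0 (t : ℝ), Real.exp (C₁ / 2 * s) with hI
  -- Since the slope is 1/(2Φ), the decay -C₁|x|² turns into -(C₁/2)Φ up to an error (C₁/2)√δ, and
  -- c|x| contributes at most c/2. This dictates the exponential weight C₁/2.
  have key : ∀ δ : ℝ, 0 < δ → Integrable (fun ω => √(lam t ω ⬝ᵥ lam t ω + δ)) P ∧
      Real.exp (C₁ / 2 * t) * ∫ ω, √(lam t ω ⬝ᵥ lam t ω + δ) ∂P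
        ≤ √(l ⬝ᵥ l + δ) + (c / 2 + C₁ / 2 * √δ) * I := by
    intro δ hδ
    have hE := isConcaveEnergy_sqrt (d := d) hδ
    have hsδ : 0 < √δ := Real.sqrt_pos.2 hδ
    have hmono : ∀ x : Fin d → ℝ, √δ ≤ √(x ⬝ᵥ x + δ) := fun x =>
      Real.sqrt_le_sqrt (by linarith [dotProduct_self_nonneg x])
    refine h.integral_energy_le hl₀ hA hc hE ?_ t ?_ ?_
    · intro x
      have h1 := dotProduct_self_nonneg x
      have h2 := hmono x
      have h3 : √(x ⬝ᵥ x) ≤ √(x ⬝ᵥ x + δ) := Real.sqrt_le_sqrt (by linarith)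
      have h4 : x ⬝ᵥ x = √(x ⬝ᵥ x + δ) ^ 2 - √δ ^ 2 := by
        rw [Real.sq_sqrt (by linarith), Real.sq_sqrt hδ.le]; ring
      rw [hγ]
      generalize √(x ⬝ᵥ x) = a at *
      generalize √(x ⬝ᵥ x + δ) = r at *
      generalize √δ = e at *
      rw [h4]
      have hr : 0 < r := by linarith
      -- The slack in the required inequality, visibly nonnegative because a ≤ r and e ≤ r.
      have h5 : c / 2 + C₁ / 2 * e
            - (C₁ / 2 * r + 1 / (2 * r) * (-C₁ * (r ^ 2 - e ^ 2) + c * a))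
          = (c * (r - a) + C₁ * e * (r - e)) / (2 * r) := by
        field_simp
        ring
      have h6 : 0 ≤ (c * (r - a) + C₁ * e * (r - e)) / (2 * r) := by
        have : 0 ≤ r - a := by linarith
        have : 0 ≤ r - e := by linarith
        positivity
      linarith
    · refine h.integrable_of_bound (F := fun _ x => √(x ⬝ᵥ x + δ)) (G := fun x => (1 + δ) * 1 + x ⬝ᵥ x)
        (hE.continuous_energy.measurable.comp measurable_snd)
        ((hone.const_mul (1 + δ)).add hf2) fun s _ x _ => ?_
      have h1 := dotProduct_self_nonneg x
      rw [abs_of_nonneg (Real.sqrt_nonneg _), Real.sqrt_le_left (by positivity)]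
      nlinarith
    · refine h.integrable_of_bound (F := fun _ x => 1 / (2 * √(x ⬝ᵥ x + δ)) * (1 + x ⬝ᵥ x))
        (G := fun x => 1 / (2 * √δ) * (1 + x ⬝ᵥ x)) ?_ ((hone.add hf2).const_mul _)
        fun s _ x _ => ?_
      · have h2 := hE.continuous_slope.measurable.comp
          (measurable_snd : Measurable (Prod.snd : ℝ≥0 × (Fin d → ℝ) → _))
        exact h2.mul (Continuous.measurable (by fun_prop))
      · have h1 := dotProduct_self_nonneg x
        have h2 := hmono x
        rw [abs_of_nonneg (by positivity)]
        gcongr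
  have hle : ∀ δ : ℝ, 0 < δ → ∀ ω, √(lam t ω ⬝ᵥ lam t ω) ≤ √(lam t ω ⬝ᵥ lam t ω + δ) :=
    fun δ hδ ω => Real.sqrt_le_sqrt (by linarith)
  have hcont : Continuous fun x : Fin d → ℝ => √(x ⬝ᵥ x) := by fun_prop
  have hint : Integrable (fun ω => √(lam t ω ⬝ᵥ lam t ω)) P := by
    refine (key 1 one_pos).1.mono'
      (hcont.measurable.comp (h.measurable_intensity t)).aestronglyMeasurable ?_
    exact Eventually.of_forall fun ω => by
      rw [Real.norm_of_nonneg (Real.sqrt_nonneg _)]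
      exact hle 1 one_pos ω
  refine ⟨hint, ?_⟩
  -- Letting δ decrease to 0 removes the regularisation.
  have hlim : Real.exp (C₁ / 2 * t) * ∫ ω, √(lam t ω ⬝ᵥ lam t ω) ∂P
      ≤ √(l ⬝ᵥ l) + c / 2 * I := by
    have h1 : Tendsto (fun δ : ℝ => √(l ⬝ᵥ l + δ) + (c / 2 + C₁ / 2 * √δ) * I) (𝓝[>] 0)
        (𝓝 (√(l ⬝ᵥ l) + c / 2 * I)) := by
      have h2 : Continuous fun δ : ℝ => √(l ⬝ᵥ l + δ) + (c / 2 + C₁ / 2 * √δ) * I := by fun_prop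
      simpa using (h2.tendsto 0).mono_left nhdsWithin_le_nhds
    refine ge_of_tendsto h1 ?_
    filter_upwards [self_mem_nhdsWithin] with δ hδ
    refine le_trans ?_ (key δ hδ).2
    exact mul_le_mul_of_nonneg_left (integral_mono hint (key δ hδ).1 (hle δ hδ))
      (Real.exp_pos _).le
  have hIval : I = (Real.exp (C₁ / 2 * t) - 1) / (C₁ / 2) := by
    rw [hI, ← intervalIntegral.integral_of_le t.coe_nonneg,
      intervalIntegral.integral_comp_mul_left (fun x => Real.exp x) (by positivity)]
    simp [div_eq_inv_mul]
  rw [hIval] at hlim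
  have h1 := mul_le_mul_of_nonneg_left hlim (Real.exp_pos (-(C₁ / 2 * t))).le
  have h2 : Real.exp (-(C₁ / 2 * t)) * Real.exp (C₁ / 2 * t) = 1 := by
    rw [← Real.exp_add]; simp
  rw [← mul_assoc, h2, one_mul] at h1
  refine h1.trans (le_of_eq ?_)
  have h3 : Real.exp (-(C₁ / 2 * t)) * (c / 2 * ((Real.exp (C₁ / 2 * t) - 1) / (C₁ / 2)))
      = c / C₁ * (Real.exp (-(C₁ / 2 * t)) * Real.exp (C₁ / 2 * t) - Real.exp (-(C₁ / 2 * t))) := by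
    field_simp
  rw [mul_add, h3, h2]
  ring

end IsLinearModel

/-! ### Arbitrary norms and the final constants -/

theorem exists_seminorm_le_sqrt {d : ℕ} (p : Seminorm ℝ (Fin d → ℝ)) :
    ∃ C > 0, ∀ x, p x ≤ C * √(x ⬝ᵥ x) := by
  refine ⟨∑ i, p (Pi.single i 1) + 1, by positivity, fun x => ?_⟩
  have h1 : p x ≤ ∑ i, p (x i • Pi.single i 1) := by
    conv_lhs => rw [pi_eq_sum_univ' x]
    refine (Finset.le_sum_of_subadditive p (map_zero p).le (map_add_le_add p) _ _).trans (le_of_eq ?_)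
    refine Finset.sum_congr rfl fun i _ => ?_
    congr 2
  refine h1.trans ?_
  rw [add_mul, Finset.sum_mul, one_mul]
  refine le_add_of_le_of_nonneg (Finset.sum_le_sum fun i _ => ?_) (Real.sqrt_nonneg _)
  rw [map_smul_eq_mul, mul_comm, Real.norm_eq_abs]
  exact mul_le_mul_of_nonneg_left (abs_apply_le_sqrt x i) (apply_nonneg p _)

theorem continuous_seminorm {d : ℕ} (p : Seminorm ℝ (Fin d → ℝ)) : Continuous p := by
  obtain ⟨C, _, hC⟩ := exists_seminorm_le_sqrt p
  refine Seminorm.continuous_of_continuousAt_zero ?_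
  have h1 : Continuous fun x : Fin d → ℝ => C * √(x ⬝ᵥ x) := by fun_prop
  have h2 : Tendsto (fun x : Fin d → ℝ => C * √(x ⬝ᵥ x)) (𝓝 0) (𝓝 0) := by
    simpa using h1.tendsto 0
  rw [ContinuousAt, map_zero]
  exact squeeze_zero (fun x => apply_nonneg p x) hC h2

/-- Interpolation of norms is dominated by interpolation of squared norms. -/
theorem interpolation_le_sqrt {r a κ : ℝ} (ha0 : 0 ≤ a) (ha1 : a ≤ 1) :
    (r * a + κ * (1 - a)) ^ 2 ≤ 2 * (κ ^ 2 + (r ^ 2 - κ ^ 2) * a ^ 2) := by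
  have h1 : 0 ≤ κ ^ 2 * (a * (1 - a)) :=
    mul_nonneg (sq_nonneg κ) (mul_nonneg ha0 (by linarith))
  nlinarith [sq_nonneg (r * a - κ * (1 - a))]

end SelfExciting

open SelfExciting in
theorem mainTheorem4 {d : ℕ} (A B : Matrix (Fin d) (Fin d) ℝ) (l₀ : Fin d → ℝ) (hl₀ : 0 ≤ l₀)
    (ν : Fin d → ProbabilityTheory.Kernel (Fin d → ℝ) ℝ)
    (hν : ∀ k, ProbabilityTheory.IsMarkovKernel (ν k))
    (hA : SelfExciting.LinearAssumption A B l₀ ν)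
    (p : Seminorm ℝ (Fin d → ℝ)) (hp : ∀ x, p x = 0 → x = 0)
    (C₁ : ℝ) (hC₁ : C₁ = -SelfExciting.supGamma A B l₀ ν) :
    0 < C₁ ∧ ∃ C > 0, ∃ C₂ > 0,
      ∀ (l : Fin d → ℝ), l₀ ≤ l →
      ∀ (Ω : Type*) [mΩ : MeasurableSpace Ω] (P : MeasureTheory.Measure Ω)
        [MeasureTheory.IsProbabilityMeasure P] (𝓕 : MeasureTheory.Filtration ℝ≥0 mΩ)
        (T : ℕ → Ω → ℝ≥0∞) (X : ℕ → Ω → Fin d) (Y : ℕ → Fin d → Ω → ℝ)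
        (lam : ℝ≥0 → Ω → Fin d → ℝ),
        SelfExciting.IsLinearModel A B l₀ ν l P 𝓕 T X Y lam →
        (∀ t : ℝ≥0,
          MeasureTheory.Integrable (fun ω => p (lam t ω)) P ∧
          ∫ ω, p (lam t ω) ∂P
            ≤ C * √(C₂ / C₁ + (l ⬝ᵥ l - C₂ / C₁) * Real.exp (-C₁ * t)) ∧
          ((0 < t ∨ l ≠ 0) →
            ∫ ω, p (lam t ω) ∂P
              < C * √(C₂ / C₁ + (l ⬝ᵥ l - C₂ / C₁) * Real.exp (-C₁ * t)))) ∧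
        BddAbove (Set.range fun t : ℝ≥0 => ∫ ω, p (lam t ω) ∂P) := by
  have hC0 : 0 < C₁ := by rw [hC₁]; exact neg_pos.2 hA.sup_neg
  obtain ⟨c, hc0, hc⟩ := hA.generator_le
  obtain ⟨Cp, hCp, hpC⟩ := exists_seminorm_le_sqrt p
  -- C₂ is chosen so that C₂/C₁ = κ² with κ = c/C₁, the long-time level in the bound for the
  -- Euclidean norm. The argument yields √2·Cp; taking 2·Cp leaves room for strictness.
  refine ⟨hC0, 2 * Cp, by positivity, (c / C₁) ^ 2 * C₁, by positivity, ?_⟩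
  intro l hl Ω mΩ P hP 𝓕 T X Y lam h
  set κ := c / C₁ with hκ
  have hκ0 : 0 < κ := by positivity
  rw [mul_div_cancel_right₀ _ hC0.ne']
  set Q : ℝ≥0 → ℝ := fun t => κ ^ 2 + (l ⬝ᵥ l - κ ^ 2) * Real.exp (-C₁ * t) with hQ
  have hexp1 : ∀ t : ℝ≥0, Real.exp (-C₁ * t) ≤ 1 := fun t =>
    Real.exp_le_one_iff.2 (mul_nonpos_of_nonpos_of_nonneg (neg_nonpos.2 hC0.le) t.coe_nonneg)
  have hint : ∀ t, Integrable (fun ω => p (lam t ω)) P := fun t =>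
    ((h.integral_sqrt_le hl₀ hA hc0.le hc t hC₁).1.const_mul Cp).mono'
      ((continuous_seminorm p).measurable.comp (h.measurable_intensity t)).aestronglyMeasurable
      (Eventually.of_forall fun ω => by
        rw [Real.norm_of_nonneg (apply_nonneg p _)]
        exact hpC _)
  -- Q is a convex combination of κ² and |l|², hence nonnegative. Its first term is positive for t >
  -- 0 and its second for l ≠ 0, which yields the strict inequality.
  have hQl : ∀ t, Q t = κ ^ 2 * (1 - Real.exp (-C₁ * t)) + (l ⬝ᵥ l) * Real.exp (-C₁ * t) :=
    fun t => by simp only [hQ]; ring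
  have hQ0 : ∀ t, 0 ≤ Q t := fun t => by
    rw [hQl]
    exact add_nonneg (mul_nonneg (sq_nonneg κ) (sub_nonneg.2 (hexp1 t)))
      (mul_nonneg (dotProduct_self_nonneg l) (Real.exp_pos _).le)
  have hbound : ∀ t, ∫ ω, p (lam t ω) ∂P ≤ Cp * √(2 * Q t) := by
    intro t
    obtain ⟨hi, hle⟩ := h.integral_sqrt_le hl₀ hA hc0.le hc t hC₁
    have h1 : ∫ ω, p (lam t ω) ∂P ≤ Cp * ∫ ω, √(lam t ω ⬝ᵥ lam t ω) ∂P := by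
      rw [← integral_const_mul]
      exact integral_mono (hint t) (hi.const_mul Cp) fun ω => hpC _
    refine h1.trans (mul_le_mul_of_nonneg_left (hle.trans ?_) hCp.le)
    refine Real.le_sqrt_of_sq_le ?_
    -- The interpolation weight a = exp(-C₁t/2) squares to the decay factor of the statement.
    have h2 : Real.exp (-(C₁ / 2 * t)) ^ 2 = Real.exp (-C₁ * t) := by
      rw [← Real.exp_nat_mul]; congr 1; push_cast; ring
    have h3 := interpolation_le_sqrt (r := √(l ⬝ᵥ l)) (κ := κ)
      (Real.exp_pos (-(C₁ / 2 * t))).le (Real.exp_le_one_iff.2 (by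
        rw [neg_nonpos]; positivity))
    rwa [h2, Real.sq_sqrt (dotProduct_self_nonneg l)] at h3
  have hsqrt : ∀ t, Cp * √(2 * Q t) ≤ 2 * Cp * √(Q t) := by
    intro t
    rw [Real.sqrt_mul zero_le_two, mul_comm 2 Cp, mul_assoc]
    have h1 : √2 ≤ 2 := (Real.sqrt_le_left zero_le_two).2 (by norm_num)
    gcongr
  refine ⟨fun t => ⟨hint t, (hbound t).trans (hsqrt t), fun ht => ?_⟩, ?_⟩
  · refine (hbound t).trans_lt ?_
    have hQpos : 0 < Q t := by
      rw [hQl]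
      rcases ht with ht | ht
      · have h1 : Real.exp (-C₁ * t) < 1 := Real.exp_lt_one_iff.2 (by
          have : (0 : ℝ) < t := by exact_mod_cast ht
          nlinarith)
        exact add_pos_of_pos_of_nonneg (mul_pos (by positivity) (sub_pos.2 h1))
          (mul_nonneg (dotProduct_self_nonneg l) (Real.exp_pos _).le)
      · have h1 : 0 < l ⬝ᵥ l := (dotProduct_self_nonneg l).lt_of_ne fun h0 =>
          ht (dotProduct_self_eq_zero.1 h0.symm)
        exact add_pos_of_nonneg_of_pos (mul_nonneg (sq_nonneg κ) (sub_nonneg.2 (hexp1 t)))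
          (mul_pos h1 (Real.exp_pos _))
    rw [Real.sqrt_mul zero_le_two, mul_comm 2 Cp, mul_assoc]
    have h1 : √2 < 2 := (Real.sqrt_lt' two_pos).2 (by norm_num)
    have h2 := Real.sqrt_pos.2 hQpos
    gcongr
  · refine ⟨Cp * √(2 * (κ ^ 2 + l ⬝ᵥ l)), ?_⟩
    rintro _ ⟨t, rfl⟩
    refine (hbound t).trans ?_
    have h1 : Q t ≤ κ ^ 2 + l ⬝ᵥ l := by
      rw [hQl]
      have h2 := mul_le_mul_of_nonneg_left (hexp1 t) (dotProduct_self_nonneg l)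
      have h3 : 0 ≤ κ ^ 2 * Real.exp (-C₁ * t) := by positivity
      nlinarith
    gcongr
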